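/- Let $w$ be a continuous probability density on $[0,1]$, let $\epsilon>0$ and $\alpha\in\,]0,2[$, and let $E_n>\epsilon n(n-1)/2$ ($n\ge 2$) be energies such that $\alpha_n:=\epsilon n(n-1)/E_n\to\alpha$ as $n\to\infty$. Put $\epsilon_n:=\epsilon n/E_n=\alpha_n/(n-1)$ and let $$\mathcal S_n:=\Big\{x\in[0,\infty[^n:\ \sum_{j=1}^n x_j=n,\ |x_i-x_j|>\epsilon_n\ (i\ne j)\Big\},$$ and let $\overline{\mathcal S}_n$ be the same set with $\ge\epsilon_n$ in place of $>\epsilon_n$. On the simplex $S_1=\{z\in[0,\infty[^n:\sum_j z_j=1\}$ define $T_n(z)=(x_1,\dots,x_n)$ by $$x_j=n\Big(1-\frac{\alpha_n}{2}\Big)\sum_{k=1}^{j}\frac{z_k}{n+1-k}+\frac{j-1}{n-1}\,\alpha_n .$$ Set $w_j=\int_{(j-1)/n}^{j/n}w(\xi)\,d\xi$, and let $\tau_n$ be the Dirichlet distribution on $S_1$ with parameters $(nw_1,\dots,nw_n)$, that is, with density $\Gamma(n)\prod_{j}\Gamma(nw_j)^{-1}z_j^{nw_j-1}$ (if some $w_j$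 vanish, the corresponding $z_j$ are $0$ and the remaining coordinates have the Dirichlet distribution with the positive parameters). Let $\hat\tau_n$ be the push-forward of $\tau_n$ under $T_n$, averaged over all permutations of the coordinates. Let $$\phi(\xi)=\Big(1-\frac{\alpha}{2}\Big)\int_0^\xi\frac{w(t)}{1-t}\,dt+\alpha\xi\quad(0\le\xi<1),\qquad g(x)=\frac{1}{\phi'(\phi^{-1}(x))}\ \text{ for }x\in\phi([0,1[),$$ and $g(x)=0$ for all other $x$. Then $\{\hat\tau_n\}_{n\ge2}$ is $(\alpha,g)$-chaotic: $g$ is a probability density on $[0,\infty[$; each $\hat\tau_n$ with $n\ge 2$ is a probability measure carried by $\overline{\mathcal S}_n$ (and by $\mathcal S_n$ if $w_1,\dots,w_n>0$); and if $(x_1,\dots,x_n)$ has law $\hat\tau_n$, then the empirical measures $\mu_n=\frac1n\sum_{j=1}^n\delta_{x_j}$ converge weakly to $g(x)\,dx$ in probability, i.e. for every bounded continuous $\chi:\mathbb R\to\mathbb R$ and every $\delta>0$, $$\lim_{n\to\infty}\hat\tau_n\Big\{\Big|\int\chi\,d\mu_n-\int_0^\infty\chi(x)g(x)\,dx\Big|>\delta\Big\}=0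 .$$ -/

import Mathlib

open Filter MeasureTheory Topology
open scoped ENNReal BoundedContinuousFunction

noncomputable section

/-- The parameter `α_n = ε n (n - 1) / E_n` of `n` particles with total energy `E n` whose energies
keep distance `ε`. -/
def exclusionRatio (ε : ℝ) (E : ℕ → ℝ) (n : ℕ) : ℝ :=
  ε * n * (n - 1) / E n

/-- The rescaled minimal spacing `ε_n = ε n / E_n = α_n / (n - 1)`. -/
def rescaledSpacing (ε : ℝ) (E : ℕ → ℝ) (n : ℕ) : ℝ :=
  ε * n / E n

/-- The simplex with exclusion in rescaled variables: nonnegative energies with sum `n` and pairwise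
distances larger than `δ`. -/
def stateSpace (n : ℕ) (δ : ℝ) : Set (Fin n → ℝ) :=
  {x | (∀ j, 0 ≤ x j) ∧ ∑ j, x j = n ∧ ∀ i j, i ≠ j → δ < |x i - x j|}

/-- The same set with the non-strict exclusion condition. -/
def closedStateSpace (n : ℕ) (δ : ℝ) : Set (Fin n → ℝ) :=
  {x | (∀ j, 0 ≤ x j) ∧ ∑ j, x j = n ∧ ∀ i j, i ≠ j → δ ≤ |x i - x j|}

/-- The empirical measure `(1/n) ∑ δ_{x_j}`. -/
def empiricalMeasure {n : ℕ} (x : Fin n → ℝ) : Measure ℝ :=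
  (n : ℝ≥0∞)⁻¹ • ∑ j, Measure.dirac (x j)

/-- `f` is a probability density on `[0, ∞)`; values at negative arguments play no role. -/
structure IsDensityOnHalfLine (f : ℝ → ℝ) : Prop where
  nonneg : ∀ x, 0 ≤ x → 0 ≤ f x
  integrable : IntegrableOn f (Set.Ici 0)
  integral_eq_one : ∫ x in Set.Ici (0 : ℝ), f x = 1

/-- The sequence `F n` (`n ≥ 2`) of probability measures on the state spaces is `(α, f)`-chaotic:
`α_n → α`, and the empirical measures converge in probability, for the weak topology, to the
measure with density `f`. The boundary of the state space, where some distance is equal to the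
minimal spacing, is allowed to carry mass. -/
structure IsChaotic (ε : ℝ) (E : ℕ → ℝ) (α : ℝ) (f : ℝ → ℝ)
    (F : (n : ℕ) → Measure (Fin n → ℝ)) : Prop where
  pos : 0 < α
  density : IsDensityOnHalfLine f
  tendsto_ratio : Tendsto (exclusionRatio ε E) atTop (𝓝 α)
  isProbabilityMeasure : ∀ n, 2 ≤ n → IsProbabilityMeasure (F n)
  mem_stateSpace : ∀ n, 2 ≤ n → ∀ᵐ x ∂(F n), x ∈ closedStateSpace n (rescaledSpacing ε E n)
  tendsto_empirical : ∀ χ : ℝ →ᵇ ℝ, ∀ δ : ℝ, 0 < δ →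
    Tendsto (fun n => F n {x | δ < |∫ y, χ y ∂(empiricalMeasure x)
      - ∫ y in Set.Ici (0 : ℝ), χ y * f y|}) atTop (𝓝 0)

/-- The map `T_n` at parameter `α`, with indices starting at `0`: component `j` is
`n (1 - α/2) ∑_{k ≤ j} z_k / (n - k) + (j / (n - 1)) α`. -/
def simplexParam (n : ℕ) (α : ℝ) (z : Fin n → ℝ) : Fin n → ℝ :=
  fun j => n * (1 - α / 2) * (∑ k ∈ Finset.Iic j, z k / ((n : ℝ) - (k : ℕ)))
    + ((j : ℕ) : ℝ) / ((n : ℝ) - 1) * α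

/-- The Lebesgue measure on the affine space `{z | ∑ z_j = 1, z_j = 0 for j ∉ s}` for `k ∈ s`,
parametrized by the coordinates in `s` other than `k`: these carry Lebesgue measure, the
coordinates outside `s` are `0`, and coordinate `k` is one minus the sum of the others. -/
def faceVolume {n : ℕ} (s : Finset (Fin n)) (k : Fin n) : Measure (Fin n → ℝ) :=
  (Measure.pi fun j => if j ∈ s ∧ j ≠ k then (volume : Measure ℝ) else Measure.dirac 0).map
    fun y => y + Pi.single k (1 - ∑ j, y j)

/-- The Dirichlet density with parameters `a j`, `j ∈ s`, on the relatively open face of the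
standard simplex spanned by `s`. -/
def dirichletDensity {n : ℕ} (s : Finset (Fin n)) (a : Fin n → ℝ) (z : Fin n → ℝ) : ℝ :=
  open Classical in
  if ∀ j ∈ s, 0 < z j then
    (∏ j ∈ s, Real.Gamma (a j))⁻¹ * Real.Gamma (∑ j ∈ s, a j) * ∏ j ∈ s, z j ^ (a j - 1)
  else 0

/-- The indices with positive parameter. -/
def posIndices {n : ℕ} (a : Fin n → ℝ) : Finset (Fin n) :=
  Finset.univ.filter fun j => 0 < a j

/-- The Dirichlet distribution with nonnegative parameters `a`, not all zero. If all parameters are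
positive, this is the usual density on the simplex, with respect to Lebesgue measure in all
coordinates but the last. Components with parameter zero are zero almost surely, and the others
have the Dirichlet distribution with the positive parameters. -/
def dirichletMeasure {n : ℕ} (a : Fin n → ℝ) : Measure (Fin n → ℝ) :=
  if h : (posIndices a).Nonempty then
    (faceVolume (posIndices a) ((posIndices a).max' h)).withDensity
      fun z => ENNReal.ofReal (dirichletDensity (posIndices a) a z)
  else 0

/-- The average of a measure over all permutations of the coordinates. -/
def permutationAverage {n : ℕ} (μ : Measure (Fin n → ℝ)) : Measure (Fin n → ℝ) :=
  (n.factorial : ℝ≥0∞)⁻¹ • ∑ π : Equiv.Perm (Fin n), μ.map fun x => x ∘ π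

/-- The mass that `w` gives to the cells of the uniform partition of `[0, 1]` into `n` intervals. -/
def cellWeight (w : ℝ → ℝ) (n : ℕ) (j : Fin n) : ℝ :=
  ∫ t in (((j : ℕ) : ℝ) / n)..((((j : ℕ) : ℝ) + 1) / n), w t

/-- The push-forward under `T_n`, at parameter `α_n`, of the Dirichlet distribution with parameters
`n w_1, …, n w_n`, averaged over permutations. -/
def dirichletState (w : ℝ → ℝ) (ε : ℝ) (E : ℕ → ℝ) (n : ℕ) : Measure (Fin n → ℝ) :=
  permutationAverage
    ((dirichletMeasure fun j => n * cellWeight w n j).map (simplexParam n (exclusionRatio ε E n)))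

/-- The limiting quantile function `φ(ξ) = (1 - α/2) ∫_0^ξ w(t)/(1-t) dt + α ξ` for `0 ≤ ξ < 1`. -/
def quantile (w : ℝ → ℝ) (α : ℝ) (ξ : ℝ) : ℝ :=
  (1 - α / 2) * (∫ t in (0 : ℝ)..ξ, w t / (1 - t)) + α * ξ

/-- The density `g(x) = 1 / φ'(φ⁻¹(x))` on the range of `φ` over `[0, 1)`, extended by zero. -/
def limitDensity (w : ℝ → ℝ) (α : ℝ) (x : ℝ) : ℝ :=
  open Classical in
  if x ∈ quantile w α '' Set.Ico 0 1 then
    1 / derivWithin (quantile w α) (Set.Ico 0 1)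
      (Function.invFunOn (quantile w α) (Set.Ico 0 1) x)
  else 0

end

/-! Under `T_n` each component is an affine function of a Dirichlet vector. With parameters `n w_j`
of total `n`, coordinate `z_k` has mean `w_k`, and a linear form `∑ c_k z_k` has variance at most `∑
c_k² w_k / (n + 1)`. For component `⌊nξ⌋` with `ξ < 1` the coefficients are at most `1 / (1 - ξ)`,
so the variance is `O(1/n)`. The mean is a Riemann sum plus a linear term and tends to `φ(ξ)`. Thus
the component of index `⌊nξ⌋` tends to `φ(ξ)` in `L²`, for every fixed `ξ < 1`.

For bounded continuous `χ` this gives `E|χ(x_⌊nξ⌋) - χ(φ(ξ))| → 0` pointwise in `ξ`. An average over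
`j < n` is the integral over `ξ ∈ [0, 1)` of its term of index `⌊nξ⌋`, so dominated convergence
(`tendsto_average_of_tendsto_floor`) gives convergence of `(1/n) ∑ χ(x_j)` to `∫ χ(φ(ξ)) dξ` in
mean. The bound by `2‖χ‖` replaces any uniform estimate near `ξ = 1`, where `φ` may be unbounded.
Markov's inequality turns this into convergence in probability, and the substitution `x = φ(ξ)`
identifies the limit as `∫ χ g`.

Dirichlet moments come from one identity: multiplying the density by `z_i` raises the parameter
`a_i` by one, up to the factor `a_i / ∑ a_j` (`dirichletDensity_mul`). The total mass is computed by
convolving Riemann–Liouville kernels. The events of interest are invariant under permutations, so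
the average over permutations can be dropped. -/

/-! ### Normalization of the Dirichlet density -/

/-- The Riemann–Liouville kernel `u ^ (a - 1) / Γ(a)` on the positive half-line. -/
noncomputable def rieszKernel (a u : ℝ) : ℝ≥0∞ :=
  ENNReal.ofReal (if 0 < u then u ^ (a - 1) / Real.Gamma a else 0)

@[fun_prop]
theorem measurable_rieszKernel (a : ℝ) : Measurable (rieszKernel a) :=
  (Measurable.ite measurableSet_Ioi (by fun_prop) (by fun_prop)).ennreal_ofReal

theorem lintegral_eq_ofReal_mul_comp_mul {f : ℝ → ℝ≥0∞} (hf : Measurable f) {c : ℝ} (hc : 0 < c) :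
    ∫⁻ u, f u = ENNReal.ofReal c * ∫⁻ v, f (c * v) := by
  have h := Real.smul_map_volume_mul_left hc.ne'
  conv_lhs => rw [← h]
  rw [lintegral_smul_measure, lintegral_map hf (measurable_const_mul c), abs_of_pos hc]
  rfl

/-- The Riemann–Liouville kernels form a convolution semigroup. -/
theorem lintegral_rieszKernel_mul {a b : ℝ} (ha : 0 < a) (hb : 0 < b) (c : ℝ) :
    ∫⁻ u, rieszKernel a u * rieszKernel b (c - u) = rieszKernel (a + b) c := by
  rcases le_or_gt c 0 with hc | hc
  · have h : ∀ u, rieszKernel a u * rieszKernel b (c - u) = 0 := by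
      intro u
      by_cases hu : 0 < u
      · have : ¬ 0 < c - u := by linarith
        simp only [rieszKernel, if_neg this, ENNReal.ofReal_zero, mul_zero]
      · simp only [rieszKernel, if_neg hu, ENNReal.ofReal_zero, zero_mul]
    simp_rw [h, lintegral_zero, rieszKernel, if_neg hc.not_gt, ENNReal.ofReal_zero]
  · rw [lintegral_eq_ofReal_mul_comp_mul (by fun_prop) hc]
    have hΓ := Real.Gamma_pos_of_pos ha
    have hΓ' := Real.Gamma_pos_of_pos hb
    have hΓ'' := Real.Gamma_pos_of_pos (add_pos ha hb)
    -- After the substitution `u = c v` the integrand is a multiple of the Beta density, whose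
    -- integral is one.
    have h : ∀ v, rieszKernel a (c * v) * rieszKernel b (c - c * v)
        = ENNReal.ofReal (c ^ (a + b - 2) / Real.Gamma (a + b))
          * ProbabilityTheory.betaPDF a b v := by
      intro v
      rw [ProbabilityTheory.betaPDF_eq, rieszKernel, rieszKernel, ← ENNReal.ofReal_mul,
        ← ENNReal.ofReal_mul (by positivity)]
      · congr 1
        by_cases hv : 0 < v ∧ v < 1
        · have h1 : 0 < c * v := mul_pos hc hv.1
          have h2 : 0 < 1 - v := by linarith [hv.2]
          have h3 : c - c * v = c * (1 - v) := by ring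
          rw [if_pos hv, if_pos h1, h3, if_pos (mul_pos hc h2), Real.mul_rpow hc.le hv.1.le,
            Real.mul_rpow hc.le h2.le, ProbabilityTheory.beta,
            show a + b - 2 = (a - 1) + (b - 1) by ring, Real.rpow_add hc]
          field_simp
        · rw [if_neg hv, mul_zero]
          rcases not_and_or.1 hv with h | h
          · rw [if_neg (fun h' => h (pos_of_mul_pos_right h' hc.le)), zero_mul]
          · rw [if_neg (fun h' : 0 < c - c * v => h (by nlinarith)), mul_zero]
      · split_ifs
        · exact div_nonneg (Real.rpow_nonneg (by positivity) _) hΓ.le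
        · exact le_rfl
    have hβ : Measurable (ProbabilityTheory.betaPDF a b) :=
      (ProbabilityTheory.measurable_betaPDFReal a b).ennreal_ofReal
    simp_rw [h]
    rw [lintegral_const_mul _ hβ,
      ProbabilityTheory.lintegral_betaPDF_eq_one ha hb, mul_one, ← ENNReal.ofReal_mul hc.le,
      rieszKernel, if_pos hc, show a + b - 1 = 1 + (a + b - 2) by ring, Real.rpow_add hc,
      Real.rpow_one]
    congr 1
    ring

/-- The measures whose product parametrizes a face of the simplex. -/
noncomputable def faceFactor {n : ℕ} (s : Finset (Fin n)) (k j : Fin n) : Measure ℝ :=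
  if j ∈ s ∧ j ≠ k then volume else Measure.dirac 0

instance {n : ℕ} (s : Finset (Fin n)) (k j : Fin n) : SigmaFinite (faceFactor s k j) := by
  unfold faceFactor
  split_ifs <;> infer_instance

/-- Each Lebesgue coordinate convolves its kernel with the one accumulated so far, and each Dirac
coordinate contributes nothing. The statement is for all `c` because integrating out a coordinate
with value `u` shifts `c` to `c - u`. -/
theorem lmarginal_rieszKernel {n : ℕ} (s : Finset (Fin n)) (k : Fin n) (a : Fin n → ℝ)
    (ha : ∀ j ∈ s, 0 < a j) (hk : k ∈ s) (t : Finset (Fin n)) :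
    ∀ (c : ℝ) (x : Fin n → ℝ),
    (∫⋯∫⁻_t, (fun y => (∏ j ∈ t, if j ∈ s ∧ j ≠ k then rieszKernel (a j) (y j) else 1)
      * rieszKernel (a k) (c - ∑ j ∈ t, y j)) ∂(faceFactor s k)) x
    = rieszKernel (a k + ∑ j ∈ t, if j ∈ s ∧ j ≠ k then a j else 0) c := by
  have hm : ∀ (t : Finset (Fin n)) (c : ℝ), Measurable fun y : Fin n → ℝ =>
      (∏ j ∈ t, if j ∈ s ∧ j ≠ k then rieszKernel (a j) (y j) else 1)
      * rieszKernel (a k) (c - ∑ j ∈ t, y j) := by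
    intro t c
    refine Measurable.mul (Finset.measurable_prod _ fun j _ => ?_) (by fun_prop)
    split_ifs <;> fun_prop
  induction t using Finset.induction_on with
  | empty => simp
  | insert i t hi ih =>
    intro c x
    rw [lmarginal_insert _ (hm _ c) hi]
    have key : ∀ u, (∫⋯∫⁻_t, (fun y => (∏ j ∈ insert i t,
        if j ∈ s ∧ j ≠ k then rieszKernel (a j) (y j) else 1)
        * rieszKernel (a k) (c - ∑ j ∈ insert i t, y j)) ∂(faceFactor s k))
          (Function.update x i u)
        = (if i ∈ s ∧ i ≠ k then rieszKernel (a i) u else 1)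
          * rieszKernel (a k + ∑ j ∈ t, if j ∈ s ∧ j ≠ k then a j else 0) (c - u) := by
      intro u
      rw [← ih (c - u) (Function.update x i u)]
      simp only [lmarginal]
      rw [← lintegral_const_mul]
      · refine lintegral_congr fun y => ?_
        have : Function.updateFinset (Function.update x i u) t y i = u := by
          simp [Function.updateFinset, hi]
        rw [Finset.prod_insert hi, Finset.sum_insert hi, this, mul_assoc, sub_sub]
      · exact (hm t (c - u)).comp measurable_updateFinset
    simp_rw [key]
    by_cases h : i ∈ s ∧ i ≠ k
    · simp only [h, ne_eq, not_false_eq_true, and_self, if_true, faceFactor]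
      rw [lintegral_rieszKernel_mul (ha i h.1), Finset.sum_insert hi, if_pos h]
      · congr 1; ring
      · refine add_pos_of_pos_of_nonneg (ha k hk) (Finset.sum_nonneg fun j _ => ?_)
        split_ifs with hj
        exacts [(ha j hj.1).le, le_rfl]
    · simp only [if_neg h, faceFactor, one_mul]
      rw [lintegral_dirac' _ (by fun_prop), Finset.sum_insert hi, if_neg h, zero_add, sub_zero]

theorem lintegral_faceVolume {n : ℕ} (s : Finset (Fin n)) (k : Fin n) {f : (Fin n → ℝ) → ℝ≥0∞}
    (hf : Measurable f) :
    ∫⁻ z, f z ∂(faceVolume s k)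
      = ∫⁻ y, f (y + Pi.single k (1 - ∑ j, y j)) ∂(Measure.pi (faceFactor s k)) := by
  rw [faceVolume, lintegral_map hf]
  · rfl
  · refine Measurable.add measurable_id ?_
    refine measurable_pi_lambda _ fun i => ?_
    simp only [Pi.single_apply]
    split_ifs <;> fun_prop

theorem ae_faceFactor {n : ℕ} (s : Finset (Fin n)) (k : Fin n) :
    ∀ᵐ y ∂(Measure.pi (faceFactor s k)), ∀ j, ¬ (j ∈ s ∧ j ≠ k) → y j = 0 := by
  rw [ae_all_iff]
  intro j
  by_cases h : j ∈ s ∧ j ≠ k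
  · simp [h]
  · have : ∀ᵐ u ∂(faceFactor s k j), u = 0 := by
      rw [faceFactor, if_neg h, ae_dirac_eq]
      exact rfl
    filter_upwards [(Measure.quasiMeasurePreserving_eval _ j).ae this] with y hy _ using hy

theorem measurable_dirichletDensity {n : ℕ} (s : Finset (Fin n)) (a : Fin n → ℝ) :
    Measurable (dirichletDensity s a) := by
  unfold dirichletDensity
  refine Measurable.ite ?_ (by fun_prop) measurable_const
  have : {z : Fin n → ℝ | ∀ j ∈ s, 0 < z j} = ⋂ j ∈ s, {z | 0 < z j} := by ext; simp
  rw [this]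
  exact MeasurableSet.biInter s.countable_toSet fun j _ =>
    measurableSet_lt measurable_const (measurable_pi_apply j)

/-- The kernels vanish off the positive half-line, so the product encodes the positivity condition
of the density and the convolution formula applies. -/
theorem ofReal_dirichletDensity {n : ℕ} (s : Finset (Fin n)) (a : Fin n → ℝ)
    (ha : ∀ j ∈ s, 0 < a j) (z : Fin n → ℝ) :
    ENNReal.ofReal (dirichletDensity s a z)
      = ENNReal.ofReal (Real.Gamma (∑ j ∈ s, a j)) * ∏ j ∈ s, rieszKernel (a j) (z j) := by
  unfold dirichletDensity
  split_ifs with h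
  · have h1 : ∀ j ∈ s, rieszKernel (a j) (z j)
        = ENNReal.ofReal (z j ^ (a j - 1) / Real.Gamma (a j)) := fun j hj => by
      rw [rieszKernel, if_pos (h j hj)]
    rw [Finset.prod_congr rfl h1, ← ENNReal.ofReal_prod_of_nonneg, ← ENNReal.ofReal_mul']
    · rw [Finset.prod_div_distrib]
      congr 1
      ring
    · exact Finset.prod_nonneg fun j hj => div_nonneg (Real.rpow_nonneg (h j hj).le _)
        (Real.Gamma_pos_of_pos (ha j hj)).le
    · exact fun j hj => div_nonneg (Real.rpow_nonneg (h j hj).le _)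
        (Real.Gamma_pos_of_pos (ha j hj)).le
  · push Not at h
    obtain ⟨j, hj, hz⟩ := h
    rw [ENNReal.ofReal_zero, Finset.prod_eq_zero hj, mul_zero]
    simp [rieszKernel, hz.not_gt]

/-- **Dirichlet integral.** -/
theorem lintegral_dirichletDensity {n : ℕ} (s : Finset (Fin n)) {k : Fin n} (hk : k ∈ s)
    (a : Fin n → ℝ) (ha : ∀ j ∈ s, 0 < a j) :
    ∫⁻ z, ENNReal.ofReal (dirichletDensity s a z) ∂(faceVolume s k) = 1 := by
  have hA : 0 < ∑ j ∈ s, a j := Finset.sum_pos ha ⟨k, hk⟩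
  rw [lintegral_faceVolume s k (measurable_dirichletDensity s a).ennreal_ofReal]
  -- Coordinate `k` of `y` is almost surely `0`, so after the shift it equals `1 - ∑ y_j`; its
  -- kernel is the one with argument `c - ∑ y_j` at `c = 1`.
  have h : ∀ᵐ y ∂(Measure.pi (faceFactor s k)),
      ENNReal.ofReal (dirichletDensity s a (y + Pi.single k (1 - ∑ j, y j)))
      = ENNReal.ofReal (Real.Gamma (∑ j ∈ s, a j)) *
        ((∏ j, if j ∈ s ∧ j ≠ k then rieszKernel (a j) (y j) else 1)
        * rieszKernel (a k) (1 - ∑ j, y j)) := by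
    filter_upwards [ae_faceFactor s k] with y hy
    rw [ofReal_dirichletDensity s a ha, ← Finset.mul_prod_erase s _ hk, mul_comm (rieszKernel _ _),
      Finset.prod_ite, Finset.prod_const_one, mul_one]
    congr 2
    · refine Finset.prod_congr (by ext; simp [and_comm]) fun j hj => ?_
      simp only [Finset.mem_filter] at hj
      simp [hj.2.2]
    · simp [hy k (by simp)]
  rw [lintegral_congr_ae h, lintegral_const_mul', lintegral_eq_lmarginal_univ (0 : Fin n → ℝ),
    lmarginal_rieszKernel s k a ha hk Finset.univ]
  · have : a k + ∑ j, (if j ∈ s ∧ j ≠ k then a j else 0) = ∑ j ∈ s, a j := by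
      rw [← Finset.add_sum_erase s _ hk, ← Finset.sum_filter]
      congr 2
      ext; simp [and_comm]
    rw [this, rieszKernel, if_pos one_pos, Real.one_rpow, ← ENNReal.ofReal_mul
      (Real.Gamma_pos_of_pos hA).le, mul_one_div_cancel (Real.Gamma_pos_of_pos hA).ne',
      ENNReal.ofReal_one]
  · exact ENNReal.ofReal_ne_top

/-! ### Moments of the Dirichlet distribution -/

/-- The Dirichlet distribution on the face of the simplex spanned by `s`. -/
noncomputable def faceDirichlet {n : ℕ} (s : Finset (Fin n)) (k : Fin n) (a : Fin n → ℝ) :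
    Measure (Fin n → ℝ) :=
  (faceVolume s k).withDensity fun z => ENNReal.ofReal (dirichletDensity s a z)

theorem isProbabilityMeasure_faceDirichlet {n : ℕ} {s : Finset (Fin n)} {k : Fin n} (hk : k ∈ s)
    {a : Fin n → ℝ} (ha : ∀ j ∈ s, 0 < a j) : IsProbabilityMeasure (faceDirichlet s k a) :=
  ⟨by rw [faceDirichlet, withDensity_apply _ MeasurableSet.univ, Measure.restrict_univ,
    lintegral_dirichletDensity s hk a ha]⟩

theorem dirichletDensity_nonneg {n : ℕ} {s : Finset (Fin n)} {a : Fin n → ℝ}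
    (ha : ∀ j ∈ s, 0 < a j) (z : Fin n → ℝ) : 0 ≤ dirichletDensity s a z := by
  unfold dirichletDensity
  split_ifs with h
  · refine mul_nonneg (mul_nonneg (inv_nonneg.2 (Finset.prod_nonneg fun j hj =>
      Real.Gamma_nonneg_of_nonneg (ha j hj).le))
      (Real.Gamma_nonneg_of_nonneg (Finset.sum_nonneg fun j hj => (ha j hj).le)))
      (Finset.prod_nonneg fun j hj => Real.rpow_nonneg (h j hj).le _)
  · exact le_rfl

/-- The factor `z_i` raises one exponent; `Γ(a_i + 1) = a_i Γ(a_i)` and `Γ(A + 1) = A Γ(A)`, with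
`A` the total parameter, account for the constant. -/
theorem dirichletDensity_mul {n : ℕ} {s : Finset (Fin n)} {a : Fin n → ℝ}
    (ha : ∀ j ∈ s, 0 < a j) {i : Fin n} (hi : i ∈ s) (z : Fin n → ℝ) :
    dirichletDensity s a z * z i
      = a i / (∑ j ∈ s, a j) * dirichletDensity s (a + Pi.single i 1) z := by
  have hA : 0 < ∑ j ∈ s, a j := Finset.sum_pos ha ⟨i, hi⟩
  unfold dirichletDensity
  split_ifs with h
  · have hsum : ∑ j ∈ s, (a + Pi.single i 1 : Fin n → ℝ) j = ∑ j ∈ s, a j + 1 := by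
      simp [Finset.sum_add_distrib, Pi.single_apply, hi]
    have h1 : ∏ j ∈ s, Real.Gamma ((a + Pi.single i 1 : Fin n → ℝ) j)
        = a i * ∏ j ∈ s, Real.Gamma (a j) := by
      rw [← Finset.mul_prod_erase s _ hi, ← Finset.mul_prod_erase s (fun j => Real.Gamma (a j)) hi,
        Pi.add_apply, Pi.single_eq_same, Real.Gamma_add_one (ha i hi).ne', mul_assoc]
      congr 2
      refine Finset.prod_congr rfl fun j hj => ?_
      simp [Pi.single_eq_of_ne (Finset.ne_of_mem_erase hj)]
    have h2 : ∏ j ∈ s, z j ^ ((a + Pi.single i 1 : Fin n → ℝ) j - 1)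
        = z i * ∏ j ∈ s, z j ^ (a j - 1) := by
      rw [← Finset.mul_prod_erase s _ hi, ← Finset.mul_prod_erase s (fun j => z j ^ (a j - 1)) hi,
        Pi.add_apply, Pi.single_eq_same, ← mul_assoc]
      congr 1
      · rw [add_sub_right_comm, Real.rpow_add_one (h i hi).ne', mul_comm]
      · refine Finset.prod_congr rfl fun j hj => ?_
        simp [Pi.single_eq_of_ne (Finset.ne_of_mem_erase hj)]
    have hP : 0 < ∏ j ∈ s, Real.Gamma (a j) :=
      Finset.prod_pos fun j hj => Real.Gamma_pos_of_pos (ha j hj)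
    have := ha i hi
    rw [hsum, h1, h2, Real.Gamma_add_one hA.ne']
    field_simp
  · simp

/-- The integrands agree pointwise, so no integrability of `f` is needed and the formula can be
iterated. -/
theorem integral_faceDirichlet_mul {n : ℕ} {s : Finset (Fin n)} {k : Fin n} {a : Fin n → ℝ}
    (ha : ∀ j ∈ s, 0 < a j) {i : Fin n} (hi : i ∈ s) (f : (Fin n → ℝ) → ℝ) :
    ∫ z, z i * f z ∂(faceDirichlet s k a)
      = a i / (∑ j ∈ s, a j) * ∫ z, f z ∂(faceDirichlet s k (a + Pi.single i 1)) := by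
  have ha' : ∀ j ∈ s, 0 < (a + Pi.single i 1 : Fin n → ℝ) j := fun j hj => by
    rw [Pi.add_apply, Pi.single_apply]
    have := ha j hj
    split_ifs <;> linarith
  rw [faceDirichlet, faceDirichlet, integral_withDensity_eq_integral_toReal_smul
      (measurable_dirichletDensity s a).ennreal_ofReal (by simp),
    integral_withDensity_eq_integral_toReal_smul
      (measurable_dirichletDensity s _).ennreal_ofReal (by simp), ← integral_const_mul]
  refine integral_congr_ae (ae_of_all _ fun z => ?_)
  simp only [smul_eq_mul]
  rw [ENNReal.toReal_ofReal (dirichletDensity_nonneg ha z),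
    ENNReal.toReal_ofReal (dirichletDensity_nonneg ha' z), ← mul_assoc, ← mul_assoc,
    dirichletDensity_mul ha hi]

theorem mem_posIndices {n : ℕ} {a : Fin n → ℝ} {j : Fin n} : j ∈ posIndices a ↔ 0 < a j := by
  simp [posIndices]

theorem sum_posIndices {n : ℕ} {a : Fin n → ℝ} (ha : ∀ j, 0 ≤ a j) :
    ∑ j ∈ posIndices a, a j = ∑ j, a j := by
  refine Finset.sum_subset (Finset.subset_univ _) fun j _ hj => ?_
  rw [mem_posIndices, not_lt] at hj
  exact le_antisymm hj (ha j)

/-- Only membership of `k` in the support is retained: the moment computations do not depend on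
which coordinate is the dependent one. -/
theorem exists_dirichletMeasure_eq {n : ℕ} {a : Fin n → ℝ} (hA : 0 < ∑ j, a j) :
    ∃ k ∈ posIndices a, dirichletMeasure a = faceDirichlet (posIndices a) k a := by
  have h : (posIndices a).Nonempty := by
    by_contra h
    rw [Finset.not_nonempty_iff_eq_empty, Finset.eq_empty_iff_forall_notMem] at h
    exact hA.not_ge (Finset.sum_nonpos fun j _ => not_lt.1 fun h' => h j (mem_posIndices.2 h'))
  exact ⟨_, Finset.max'_mem _ h, by rw [dirichletMeasure, dif_pos h]; rfl⟩

theorem isProbabilityMeasure_dirichletMeasure {n : ℕ} {a : Fin n → ℝ} (hA : 0 < ∑ j, a j) :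
    IsProbabilityMeasure (dirichletMeasure a) := by
  obtain ⟨k, hk, h⟩ := exists_dirichletMeasure_eq hA
  rw [h]
  exact isProbabilityMeasure_faceDirichlet hk fun j hj => mem_posIndices.1 hj

theorem ae_faceVolume {n : ℕ} {s : Finset (Fin n)} {k : Fin n} (hk : k ∈ s) :
    ∀ᵐ z ∂(faceVolume s k), (∀ j ∉ s, z j = 0) ∧ ∑ j, z j = 1 := by
  have hm : MeasurableSet {z : Fin n → ℝ | (∀ j ∉ s, z j = 0) ∧ ∑ j, z j = 1} := by
    have : {z : Fin n → ℝ | (∀ j ∉ s, z j = 0) ∧ ∑ j, z j = 1}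
        = (⋂ j, ⋂ (_ : j ∉ s), {z | z j = 0}) ∩ {z | ∑ j, z j = 1} := by ext; simp
    rw [this]
    exact (MeasurableSet.iInter fun j => MeasurableSet.iInter fun _ =>
      measurableSet_eq_fun (measurable_pi_apply j) measurable_const).inter
      (measurableSet_eq_fun (by fun_prop) measurable_const)
  have h := lintegral_faceVolume s k (measurable_one.indicator hm.compl)
  rw [lintegral_indicator_one hm.compl] at h
  rw [ae_iff]
  refine h.trans (lintegral_eq_zero_of_ae_eq_zero ?_)
  filter_upwards [ae_faceFactor s k] with y hy
  rw [Pi.zero_apply, Set.indicator_of_notMem]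
  rw [Set.mem_compl_iff, not_not]
  refine ⟨fun j hj => ?_, ?_⟩
  · have hjk : j ≠ k := fun h => hj (h ▸ hk)
    simp [hjk, hy j (by simp [hj])]
  · simp [Finset.sum_add_distrib]

theorem ae_dirichletMeasure {n : ℕ} {a : Fin n → ℝ} (hA : 0 < ∑ j, a j) :
    ∀ᵐ z ∂(dirichletMeasure a), (∀ j, 0 < a j → 0 < z j) ∧ (∀ j, ¬ 0 < a j → z j = 0)
      ∧ ∑ j, z j = 1 := by
  obtain ⟨k, hk, h⟩ := exists_dirichletMeasure_eq hA
  rw [h, faceDirichlet, ae_withDensity_iff (measurable_dirichletDensity _ _).ennreal_ofReal]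
  filter_upwards [ae_faceVolume hk] with z hz hne
  refine ⟨?_, fun j hj => hz.1 j (mt mem_posIndices.1 hj), hz.2⟩
  by_contra hpos
  apply hne
  rw [dirichletDensity, if_neg, ENNReal.ofReal_zero]
  exact fun h' => hpos fun j hj => h' j (mem_posIndices.2 hj)

theorem ae_mem_stdSimplex_dirichletMeasure {n : ℕ} {a : Fin n → ℝ} (hA : 0 < ∑ j, a j) :
    ∀ᵐ z ∂(dirichletMeasure a), z ∈ stdSimplex ℝ (Fin n) := by
  filter_upwards [ae_dirichletMeasure hA] with z hz
  refine ⟨fun j => ?_, hz.2.2⟩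
  by_cases h : 0 < a j
  exacts [(hz.1 j h).le, (hz.2.1 j h).ge]

theorem integral_dirichletMeasure_apply {n : ℕ} {a : Fin n → ℝ} (ha : ∀ j, 0 ≤ a j)
    (hA : 0 < ∑ j, a j) (i : Fin n) :
    ∫ z, z i ∂(dirichletMeasure a) = a i / ∑ j, a j := by
  by_cases hi : 0 < a i
  · obtain ⟨k, hk, h⟩ := exists_dirichletMeasure_eq hA
    have hpos : ∀ j ∈ posIndices a, 0 < (a + Pi.single i 1 : Fin n → ℝ) j := fun j hj => by
      rw [Pi.add_apply, Pi.single_apply]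
      have := mem_posIndices.1 hj
      split_ifs <;> linarith
    have := isProbabilityMeasure_faceDirichlet hk hpos
    have h1 := integral_faceDirichlet_mul (k := k) (fun j hj => mem_posIndices.1 hj)
      (mem_posIndices.2 hi) fun _ => 1
    rw [sum_posIndices ha] at h1
    rw [h]
    simpa using h1
  · rw [le_antisymm (not_lt.1 hi) (ha i), zero_div]
    refine integral_eq_zero_of_ae ?_
    filter_upwards [ae_dirichletMeasure hA] with z hz using hz.2.1 i hi

/-- Parameter `i` is raised first, then parameter `l`. The second raise sees the total `A + 1` and,
if `i = l`, the parameter `a_i + 1`, whence the diagonal term. A coordinate with zero parameter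
vanishes almost surely, and both sides are zero. -/
theorem integral_dirichletMeasure_mul {n : ℕ} {a : Fin n → ℝ} (ha : ∀ j, 0 ≤ a j)
    (hA : 0 < ∑ j, a j) (i l : Fin n) :
    ∫ z, z i * z l ∂(dirichletMeasure a)
      = (a i * a l + if i = l then a i else 0) / ((∑ j, a j) * (∑ j, a j + 1)) := by
  by_cases hi : 0 < a i
  · by_cases hl : 0 < a l
    · obtain ⟨k, hk, h⟩ := exists_dirichletMeasure_eq hA
      have hpos : ∀ j ∈ posIndices a, 0 < (a + Pi.single i 1 : Fin n → ℝ) j := fun j hj => by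
        rw [Pi.add_apply, Pi.single_apply]
        have := mem_posIndices.1 hj
        split_ifs <;> linarith
      have hpos' : ∀ j ∈ posIndices a,
          0 < (a + Pi.single i 1 + Pi.single l 1 : Fin n → ℝ) j := fun j hj => by
        rw [Pi.add_apply, Pi.single_apply]
        have := hpos j hj
        split_ifs <;> linarith
      have := isProbabilityMeasure_faceDirichlet hk hpos'
      have hi' := mem_posIndices.2 hi
      have h1 := integral_faceDirichlet_mul (k := k) (fun j hj => mem_posIndices.1 hj) hi'
        fun z => z l
      have h2 := integral_faceDirichlet_mul (k := k) hpos (mem_posIndices.2 hl) fun _ => 1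
      have hsum : ∑ j ∈ posIndices a, (a + Pi.single i 1 : Fin n → ℝ) j = ∑ j, a j + 1 := by
        rw [← sum_posIndices ha]
        simp [Finset.sum_add_distrib, Pi.single_apply, hi']
      rw [hsum] at h2
      simp only [mul_one, integral_const, probReal_univ, smul_eq_mul] at h2
      rw [h, h1, h2, sum_posIndices ha, Pi.add_apply, Pi.single_apply]
      by_cases hil : i = l
      · subst hil
        simp only [if_true]
        field_simp
      · rw [if_neg hil, if_neg (Ne.symm hil)]
        field_simp
        ring
    · have h0 := le_antisymm (not_lt.1 hl) (ha l)
      have hil : i ≠ l := fun h => hl (h ▸ hi)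
      rw [h0, if_neg hil, mul_zero, zero_add, zero_div]
      refine integral_eq_zero_of_ae ?_
      filter_upwards [ae_dirichletMeasure hA] with z hz
      simp [hz.2.1 l hl]
  · have h0 := le_antisymm (not_lt.1 hi) (ha i)
    rw [h0, zero_mul, ite_self, zero_add, zero_div]
    refine integral_eq_zero_of_ae ?_
    filter_upwards [ae_dirichletMeasure hA] with z hz
    simp [hz.2.1 i hi]

/-- Second moment as variance plus squared mean. With `p_j = a_j / A` the covariances are `(δ_{il}
p_i - p_i p_l) / (A + 1)`; the negative part is discarded, leaving a bound of order `1 / A`. -/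
theorem integral_affine_sq_dirichletMeasure_le {n : ℕ} {a : Fin n → ℝ} (ha : ∀ j, 0 ≤ a j)
    (hA : 0 < ∑ j, a j) (c : Fin n → ℝ) (q : ℝ) :
    ∫ z, (∑ j, c j * z j + q) ^ 2 ∂(dirichletMeasure a)
      ≤ (∑ j, c j ^ 2 * (a j / ∑ i, a i)) / (∑ j, a j + 1)
        + (∑ j, c j * (a j / ∑ i, a i) + q) ^ 2 := by
  have := isProbabilityMeasure_dirichletMeasure hA
  have hb : ∀ᵐ z ∂(dirichletMeasure a), ∀ j, ‖z j‖ ≤ 1 := by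
    filter_upwards [ae_mem_stdSimplex_dirichletMeasure hA] with z hz j
    rw [Real.norm_of_nonneg (hz.1 j), ← hz.2]
    exact Finset.single_le_sum (fun i _ => hz.1 i) (Finset.mem_univ j)
  have h1 : ∀ i, Integrable (fun z : Fin n → ℝ => z i) (dirichletMeasure a) := fun i =>
    Integrable.of_bound (measurable_pi_apply i).aestronglyMeasurable 1
      (hb.mono fun z hz => hz i)
  have h2 : ∀ i l, Integrable (fun z : Fin n → ℝ => z i * z l) (dirichletMeasure a) := fun i l =>
    Integrable.of_bound (by fun_prop) 1
      (hb.mono fun z hz => by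
        rw [norm_mul]; exact mul_le_one₀ (hz i) (norm_nonneg _) (hz l))
  set A := ∑ j, a j with hAdef
  set m := ∑ j, c j * (a j / A) with hm
  have e : ∀ z : Fin n → ℝ, (∑ j, c j * z j + q) ^ 2
      = (∑ i, ∑ l, c i * c l * (z i * z l)) + (2 * q * ∑ j, c j * z j) + q ^ 2 := by
    intro z
    have : ∑ i, ∑ l, c i * c l * (z i * z l) = (∑ j, c j * z j) ^ 2 := by
      rw [sq, Finset.sum_mul_sum]
      exact Finset.sum_congr rfl fun i _ => Finset.sum_congr rfl fun l _ => by ring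
    rw [this]; ring
  have i2 : Integrable (fun z : Fin n → ℝ => ∑ i, ∑ l, c i * c l * (z i * z l))
      (dirichletMeasure a) :=
    integrable_finsetSum _ fun i _ => integrable_finsetSum _ fun l _ => (h2 i l).const_mul _
  have i1 : Integrable (fun z : Fin n → ℝ => ∑ j, c j * z j) (dirichletMeasure a) :=
    integrable_finsetSum _ fun i _ => (h1 i).const_mul _
  have m1 : ∫ z, ∑ j, c j * z j ∂(dirichletMeasure a) = m := by
    rw [integral_finsetSum _ fun i _ => (h1 i).const_mul _]
    exact Finset.sum_congr rfl fun i _ => by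
      rw [integral_const_mul, integral_dirichletMeasure_apply ha hA]
  have m2 : ∫ z, ∑ i, ∑ l, c i * c l * (z i * z l) ∂(dirichletMeasure a)
      = (A * m ^ 2 + ∑ j, c j ^ 2 * (a j / A)) / (A + 1) := by
    rw [integral_finsetSum _ fun i _ => integrable_finsetSum _ fun l _ => (h2 i l).const_mul _]
    have : ∀ i, ∫ z, ∑ l, c i * c l * (z i * z l) ∂(dirichletMeasure a)
        = (A * (c i * (a i / A) * m) + c i ^ 2 * (a i / A)) / (A + 1) := by
      intro i
      rw [integral_finsetSum _ fun l _ => (h2 i l).const_mul _]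
      have : ∀ l, ∫ z, c i * c l * (z i * z l) ∂(dirichletMeasure a)
          = A * (c i * (a i / A)) / (A + 1) * (c l * (a l / A))
            + if i = l then c i ^ 2 * (a i / A) / (A + 1) else 0 := by
        intro l
        rw [integral_const_mul, integral_dirichletMeasure_mul ha hA, ← hAdef]
        split_ifs with hil
        · subst hil
          field_simp
        · field_simp
          ring
      simp_rw [this]
      rw [Finset.sum_add_distrib, ← Finset.mul_sum, Finset.sum_ite_eq, if_pos (Finset.mem_univ i)]
      ring
    simp_rw [this]
    rw [← Finset.sum_div, Finset.sum_add_distrib, ← Finset.mul_sum, ← Finset.sum_mul, sq m]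
  simp_rw [e]
  rw [integral_add (by exact i2.add (i1.const_mul _)) (integrable_const _),
    integral_add i2 (i1.const_mul _),
    integral_const_mul, m1, m2]
  simp only [integral_const, probReal_univ, smul_eq_mul, one_mul]
  have hA1 : 0 < A + 1 := by linarith
  -- This drops the term `-m² / (A + 1)` of the variance.
  have : A * m ^ 2 / (A + 1) ≤ m ^ 2 := by
    rw [div_le_iff₀ hA1]
    nlinarith [sq_nonneg m]
  rw [add_div]
  linarith [add_sq m q]

/-! ### Permutation averages and the state spaces -/

theorem measurable_comp_perm {n : ℕ} (π : Equiv.Perm (Fin n)) :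
    Measurable fun x : Fin n → ℝ => x ∘ π :=
  measurable_pi_lambda _ fun i => measurable_pi_apply (π i)

theorem permutationAverage_apply {n : ℕ} (μ : Measure (Fin n → ℝ)) {B : Set (Fin n → ℝ)}
    (hB : MeasurableSet B) (hinv : ∀ (π : Equiv.Perm (Fin n)) (x : Fin n → ℝ), x ∈ B → x ∘ π ∈ B) :
    permutationAverage μ B = μ B := by
  have h : ∀ π : Equiv.Perm (Fin n), (μ.map fun x => x ∘ π) B = μ B := by
    intro π
    rw [Measure.map_apply (measurable_comp_perm π) hB]
    congr 1
    ext x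
    refine ⟨fun hx => ?_, fun hx => hinv π x hx⟩
    -- Invariance under `π⁻¹` recovers `x` from `x ∘ π`.
    have := hinv π⁻¹ _ hx
    rwa [Function.comp_assoc, ← Equiv.Perm.coe_mul, mul_inv_cancel, Equiv.Perm.coe_one,
      Function.comp_id] at this
  rw [permutationAverage, Measure.smul_apply, Measure.finsetSum_apply]
  simp only [h, Finset.sum_const, Finset.card_univ, Fintype.card_perm, Fintype.card_fin, smul_eq_mul,
    nsmul_eq_mul]
  rw [← mul_assoc, ENNReal.inv_mul_cancel (by exact_mod_cast n.factorial_ne_zero) (by simp), one_mul]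

theorem measurable_simplexParam (n : ℕ) (β : ℝ) : Measurable (simplexParam n β) := by
  unfold simplexParam
  fun_prop

theorem dirichletState_apply (w : ℝ → ℝ) (ε : ℝ) (E : ℕ → ℝ) (n : ℕ) {B : Set (Fin n → ℝ)}
    (hB : MeasurableSet B) (hinv : ∀ (π : Equiv.Perm (Fin n)) (x : Fin n → ℝ), x ∈ B → x ∘ π ∈ B) :
    dirichletState w ε E n B = dirichletMeasure (fun j => n * cellWeight w n j)
      (simplexParam n (exclusionRatio ε E n) ⁻¹' B) := by
  rw [dirichletState, permutationAverage_apply _ hB hinv,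
    Measure.map_apply (measurable_simplexParam n _) hB]

theorem measurableSet_nonneg_sum_eq (n : ℕ) :
    MeasurableSet {x : Fin n → ℝ | (∀ j, 0 ≤ x j) ∧ ∑ j, x j = n} := by
  have : {x : Fin n → ℝ | (∀ j, 0 ≤ x j) ∧ ∑ j, x j = n}
      = (⋂ j, {x | 0 ≤ x j}) ∩ {x | ∑ j, x j = (n : ℝ)} := by ext; simp
  rw [this]
  exact (MeasurableSet.iInter fun j => measurableSet_le measurable_const
    (measurable_pi_apply j)).inter (measurableSet_eq_fun (by fun_prop) measurable_const)

theorem measurableSet_stateSpace (n : ℕ) (δ : ℝ) : MeasurableSet (stateSpace n δ) := by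
  have : stateSpace n δ = {x : Fin n → ℝ | (∀ j, 0 ≤ x j) ∧ ∑ j, x j = n}
      ∩ ⋂ i, ⋂ j, ⋂ (_ : i ≠ j), {x | δ < |x i - x j|} := by
    ext; simp [stateSpace, and_assoc]
  rw [this]
  exact (measurableSet_nonneg_sum_eq n).inter (MeasurableSet.iInter fun i => MeasurableSet.iInter
    fun j => MeasurableSet.iInter fun _ => measurableSet_lt measurable_const (by fun_prop))

theorem measurableSet_closedStateSpace (n : ℕ) (δ : ℝ) :
    MeasurableSet (closedStateSpace n δ) := by
  have : closedStateSpace n δ = {x : Fin n → ℝ | (∀ j, 0 ≤ x j) ∧ ∑ j, x j = n}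
      ∩ ⋂ i, ⋂ j, ⋂ (_ : i ≠ j), {x | δ ≤ |x i - x j|} := by
    ext; simp [closedStateSpace, and_assoc]
  rw [this]
  exact (measurableSet_nonneg_sum_eq n).inter (MeasurableSet.iInter fun i => MeasurableSet.iInter
    fun j => MeasurableSet.iInter fun _ => measurableSet_le measurable_const (by fun_prop))

theorem comp_perm_mem_stateSpace {n : ℕ} {δ : ℝ} (π : Equiv.Perm (Fin n)) (x : Fin n → ℝ)
    (hx : x ∈ stateSpace n δ) : x ∘ π ∈ stateSpace n δ :=
  ⟨fun _ => hx.1 _, (Equiv.sum_comp π x).trans hx.2.1,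
    fun _ _ hij => hx.2.2 _ _ (π.injective.ne hij)⟩

theorem comp_perm_mem_closedStateSpace {n : ℕ} {δ : ℝ} (π : Equiv.Perm (Fin n)) (x : Fin n → ℝ)
    (hx : x ∈ closedStateSpace n δ) : x ∘ π ∈ closedStateSpace n δ :=
  ⟨fun _ => hx.1 _, (Equiv.sum_comp π x).trans hx.2.1,
    fun _ _ hij => hx.2.2 _ _ (π.injective.ne hij)⟩

theorem simplexParam_nonneg {n : ℕ} {β : ℝ} (h0 : 0 ≤ β) (h2 : β ≤ 2)
    {z : Fin n → ℝ} (hz : ∀ j, 0 ≤ z j) (j : Fin n) : 0 ≤ simplexParam n β z j := by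
  have hn : (1 : ℝ) ≤ n := by exact_mod_cast (Nat.one_le_of_lt j.2)
  refine add_nonneg (mul_nonneg (mul_nonneg (by positivity) (by linarith))
    (Finset.sum_nonneg fun k _ => div_nonneg (hz k) ?_))
    (mul_nonneg (div_nonneg (by positivity) (by linarith)) h0)
  have : ((k : ℕ) : ℝ) < n := by exact_mod_cast k.2
  linarith

/-- The term `z_k / (n - k)` occurs in the `n - k` components `j ≥ k`, so the denominators cancel
and these terms give `n (1 - β/2)`. The linear terms add up to `n β / 2`. -/
theorem sum_simplexParam {n : ℕ} (hn : 2 ≤ n) (β : ℝ) {z : Fin n → ℝ} (hz : ∑ j, z j = 1) :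
    ∑ j, simplexParam n β z j = n := by
  have h1 : ∑ j, ∑ k ∈ Finset.Iic j, z k / ((n : ℝ) - (k : ℕ)) = 1 := by
    rw [Finset.sum_comm' (t' := Finset.univ) (s' := fun k => Finset.Ici k) (by simp), ← hz]
    refine Finset.sum_congr rfl fun k _ => ?_
    have hk : ((k : ℕ) : ℝ) < n := by exact_mod_cast k.2
    rw [Finset.sum_const, Fin.card_Ici, nsmul_eq_mul, Nat.cast_sub k.2.le,
      mul_div_cancel₀ _ (by linarith)]
  have h2 : ∑ j : Fin n, ((j : ℕ) : ℝ) = n * (n - 1) / 2 := by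
    rw [Fin.sum_univ_eq_sum_range (fun j => (j : ℝ)) n]
    clear hn h1 hz z
    induction n with
    | zero => simp
    | succ m ih => rw [Finset.sum_range_succ, ih]; push_cast; ring
  have hn' : (2 : ℝ) ≤ n := by exact_mod_cast hn
  simp only [simplexParam]
  rw [Finset.sum_add_distrib, ← Finset.mul_sum, h1, ← Finset.sum_mul, ← Finset.sum_div, h2]
  have : (n : ℝ) - 1 ≠ 0 := by linarith
  field_simp
  ring

/-- From `i` to `j` the sum gains at least the term `k = j`, and the linear term gains at least one
step. The first gain is nonnegative in general and positive if `z_j > 0` and `β < 2`; this separates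
the closed from the strict exclusion condition. -/
theorem le_simplexParam_sub {n : ℕ} {β : ℝ} (h0 : 0 ≤ β) (h2 : β ≤ 2)
    {z : Fin n → ℝ} (hz : ∀ j, 0 ≤ z j) {i j : Fin n} (hij : i < j) :
    n * (1 - β / 2) * (z j / ((n : ℝ) - (j : ℕ))) + β / ((n : ℝ) - 1)
      ≤ simplexParam n β z j - simplexParam n β z i := by
  have hlt : ∀ k : Fin n, (0 : ℝ) < n - (k : ℕ) := fun k => by
    have : ((k : ℕ) : ℝ) < n := by exact_mod_cast k.2
    linarith
  have hn : (0 : ℝ) < n - 1 := by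
    have h1 : (i : ℕ) + 1 < n := lt_of_le_of_lt (Nat.succ_le_of_lt hij) j.2
    have : (1 : ℝ) < n := by exact_mod_cast (by omega : 1 < n)
    linarith
  have hsum : ∑ k ∈ Finset.Iic i, z k / ((n : ℝ) - (k : ℕ)) + z j / ((n : ℝ) - (j : ℕ))
      ≤ ∑ k ∈ Finset.Iic j, z k / ((n : ℝ) - (k : ℕ)) := by
    rw [add_comm, ← Finset.sum_insert (s := Finset.Iic i)
      (f := fun k : Fin n => z k / ((n : ℝ) - (k : ℕ))) (by simpa using hij)]
    refine Finset.sum_le_sum_of_subset_of_nonneg ?_ fun k _ _ => div_nonneg (hz k) (hlt k).le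
    intro k hk
    rw [Finset.mem_insert, Finset.mem_Iic] at hk
    rw [Finset.mem_Iic]
    rcases hk with rfl | hk
    exacts [le_rfl, hk.trans hij.le]
  have hc : 0 ≤ (n : ℝ) * (1 - β / 2) := mul_nonneg (by positivity) (by linarith)
  have h3 : β / ((n : ℝ) - 1) ≤ ((j : ℕ) : ℝ) / ((n : ℝ) - 1) * β
      - ((i : ℕ) : ℝ) / ((n : ℝ) - 1) * β := by
    have hj : ((i : ℕ) : ℝ) + 1 ≤ (j : ℕ) := by exact_mod_cast hij
    rw [← sub_mul, ← sub_div, div_mul_eq_mul_div]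
    gcongr
    nlinarith
  simp only [simplexParam]
  nlinarith [mul_le_mul_of_nonneg_left hsum hc]

theorem simplexParam_mem_closedStateSpace {n : ℕ} (hn : 2 ≤ n) {β : ℝ} (h0 : 0 ≤ β) (h2 : β ≤ 2)
    {z : Fin n → ℝ} (hz : z ∈ stdSimplex ℝ (Fin n)) :
    simplexParam n β z ∈ closedStateSpace n (β / ((n : ℝ) - 1)) := by
  refine ⟨simplexParam_nonneg h0 h2 hz.1, sum_simplexParam hn β hz.2, ?_⟩
  have key : ∀ i j : Fin n, i < j →
      β / ((n : ℝ) - 1) ≤ |simplexParam n β z j - simplexParam n β z i| := fun i j hij => by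
    have hj : ((j : ℕ) : ℝ) < n := by exact_mod_cast j.2
    have : 0 ≤ n * (1 - β / 2) * (z j / ((n : ℝ) - (j : ℕ))) :=
      mul_nonneg (mul_nonneg (by positivity) (by linarith)) (div_nonneg (hz.1 j) (by linarith))
    exact le_trans (by linarith [le_simplexParam_sub h0 h2 hz.1 hij]) (le_abs_self _)
  intro i j hij
  rcases lt_or_gt_of_ne hij with h | h
  · rw [abs_sub_comm]; exact key i j h
  · exact key j i h

theorem simplexParam_mem_stateSpace {n : ℕ} (hn : 2 ≤ n) {β : ℝ} (h0 : 0 ≤ β) (h2 : β < 2)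
    {z : Fin n → ℝ} (hz : ∀ j, 0 < z j) (hsum : ∑ j, z j = 1) :
    simplexParam n β z ∈ stateSpace n (β / ((n : ℝ) - 1)) := by
  have hz' : ∀ j, 0 ≤ z j := fun j => (hz j).le
  refine ⟨simplexParam_nonneg h0 h2.le hz', sum_simplexParam hn β hsum, ?_⟩
  have key : ∀ i j : Fin n, i < j →
      β / ((n : ℝ) - 1) < |simplexParam n β z j - simplexParam n β z i| := fun i j hij => by
    have hj : ((j : ℕ) : ℝ) < n := by exact_mod_cast j.2
    have hn0 : (0 : ℝ) < n := by exact_mod_cast (by omega : 0 < n)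
    have : 0 < n * (1 - β / 2) * (z j / ((n : ℝ) - (j : ℕ))) :=
      mul_pos (mul_pos hn0 (by linarith)) (div_pos (hz j) (by linarith))
    exact lt_of_lt_of_le (by linarith [le_simplexParam_sub h0 h2.le hz' hij]) (le_abs_self _)
  intro i j hij
  rcases lt_or_gt_of_ne hij with h | h
  · rw [abs_sub_comm]; exact key i j h
  · exact key j i h

theorem exclusionRatio_mem_Ioo {ε : ℝ} (hε : 0 < ε) {E : ℕ → ℝ} {n : ℕ} (hn : 2 ≤ n)
    (hE : ε * n * (n - 1) / 2 < E n) : exclusionRatio ε E n ∈ Set.Ioo (0 : ℝ) 2 := by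
  have hn' : (2 : ℝ) ≤ n := by exact_mod_cast hn
  have h : 0 < ε * n * (n - 1) := mul_pos (by positivity) (by linarith)
  have hEn : 0 < E n := by linarith
  refine ⟨div_pos h hEn, ?_⟩
  rw [exclusionRatio, div_lt_iff₀ hEn]
  linarith

theorem rescaledSpacing_eq (ε : ℝ) (E : ℕ → ℝ) {n : ℕ} (hn : 2 ≤ n) :
    rescaledSpacing ε E n = exclusionRatio ε E n / ((n : ℝ) - 1) := by
  have hn' : (2 : ℝ) ≤ n := by exact_mod_cast hn
  have : (n : ℝ) - 1 ≠ 0 := by linarith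
  rw [rescaledSpacing, exclusionRatio, div_right_comm, mul_div_cancel_right₀ _ this]

theorem dirichletState_ae {w : ℝ → ℝ} {ε : ℝ} {E : ℕ → ℝ} {n : ℕ} {B : Set (Fin n → ℝ)}
    (hB : MeasurableSet B) (hinv : ∀ (π : Equiv.Perm (Fin n)) (x : Fin n → ℝ), x ∈ B → x ∘ π ∈ B)
    (h : ∀ᵐ z ∂(dirichletMeasure fun j => n * cellWeight w n j),
      simplexParam n (exclusionRatio ε E n) z ∈ B) :
    ∀ᵐ x ∂(dirichletState w ε E n), x ∈ B := by
  have hinv' : ∀ (π : Equiv.Perm (Fin n)) (x : Fin n → ℝ), x ∈ Bᶜ → x ∘ π ∈ Bᶜ := by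
    intro π x hx h
    have := hinv π⁻¹ _ h
    rw [Function.comp_assoc, ← Equiv.Perm.coe_mul, mul_inv_cancel, Equiv.Perm.coe_one] at this
    exact hx this
  rw [ae_iff]
  exact (dirichletState_apply w ε E n hB.compl hinv').trans (ae_iff.1 h)

theorem dirichletState_ae_closedStateSpace {w : ℝ → ℝ} {ε : ℝ} {E : ℕ → ℝ} {n : ℕ} (hn : 2 ≤ n)
    (hA : 0 < ∑ j : Fin n, n * cellWeight w n j) (hβ : exclusionRatio ε E n ∈ Set.Ioo (0 : ℝ) 2) :
    ∀ᵐ x ∂(dirichletState w ε E n), x ∈ closedStateSpace n (rescaledSpacing ε E n) := by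
  refine dirichletState_ae (measurableSet_closedStateSpace n _) comp_perm_mem_closedStateSpace ?_
  filter_upwards [ae_mem_stdSimplex_dirichletMeasure hA] with z hz
  rw [rescaledSpacing_eq ε E hn]
  exact simplexParam_mem_closedStateSpace hn hβ.1.le hβ.2.le hz

theorem dirichletState_ae_stateSpace {w : ℝ → ℝ} {ε : ℝ} {E : ℕ → ℝ} {n : ℕ} (hn : 2 ≤ n)
    (hw : ∀ j : Fin n, 0 < cellWeight w n j) (hβ : exclusionRatio ε E n ∈ Set.Ioo (0 : ℝ) 2) :
    ∀ᵐ x ∂(dirichletState w ε E n), x ∈ stateSpace n (rescaledSpacing ε E n) := by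
  have hn0 : (0 : ℝ) < n := by exact_mod_cast (by omega : 0 < n)
  have hpos : ∀ j : Fin n, 0 < n * cellWeight w n j := fun j => mul_pos hn0 (hw j)
  have : Nonempty (Fin n) := ⟨⟨0, by omega⟩⟩
  have hA : 0 < ∑ j : Fin n, n * cellWeight w n j :=
    Finset.sum_pos (fun j _ => hpos j) Finset.univ_nonempty
  refine dirichletState_ae (measurableSet_stateSpace n _) comp_perm_mem_stateSpace ?_
  filter_upwards [ae_dirichletMeasure hA] with z hz
  rw [rescaledSpacing_eq ε E hn]
  exact simplexParam_mem_stateSpace hn hβ.1.le hβ.2 (fun j => hz.1 j (hpos j)) hz.2.2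

theorem isProbabilityMeasure_dirichletState {w : ℝ → ℝ} {ε : ℝ} {E : ℕ → ℝ} {n : ℕ}
    (hA : 0 < ∑ j : Fin n, n * cellWeight w n j) :
    IsProbabilityMeasure (dirichletState w ε E n) := by
  have := isProbabilityMeasure_dirichletMeasure hA
  refine ⟨?_⟩
  rw [dirichletState_apply w ε E n MeasurableSet.univ fun _ _ _ => Set.mem_univ _,
    Set.preimage_univ, measure_univ]

/-! ### Integrals against the empirical measure -/

theorem integral_empiricalMeasure {n : ℕ} (x : Fin n → ℝ) (χ : ℝ →ᵇ ℝ) :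
    ∫ y, χ y ∂(empiricalMeasure x) = (n : ℝ)⁻¹ * ∑ j, χ (x j) := by
  rw [empiricalMeasure, integral_smul_measure, integral_finsetSum_measure]
  · simp
  · exact fun j _ => χ.integrable _

theorem dirichletState_deviation {w : ℝ → ℝ} {ε : ℝ} {E : ℕ → ℝ} {n : ℕ} (χ : ℝ →ᵇ ℝ) (δ I : ℝ) :
    dirichletState w ε E n {x | δ < |∫ y, χ y ∂(empiricalMeasure x) - I|}
      = dirichletMeasure (fun j => n * cellWeight w n j)
        {z | δ < |(n : ℝ)⁻¹ * ∑ j, χ (simplexParam n (exclusionRatio ε E n) z j) - I|} := by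
  simp_rw [integral_empiricalMeasure]
  rw [dirichletState_apply]
  · rfl
  · refine measurableSet_lt measurable_const (Measurable.abs (Measurable.sub_const
      (Measurable.const_mul (Finset.measurable_sum _ fun j _ => ?_) _) _))
    exact χ.continuous.measurable.comp (measurable_pi_apply j)
  · intro π x hx
    simp only [Set.mem_ofPred_eq, Function.comp_apply] at hx ⊢
    rwa [Equiv.sum_comp π fun j => χ (x j)]

/-! ### The quantile function and the limit density -/

theorem continuousOn_weight_div {w : ℝ → ℝ} (hw : ContinuousOn w (Set.Icc 0 1)) :
    ContinuousOn (fun t => w t / (1 - t)) (Set.Ico 0 1) :=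
  (hw.mono Set.Ico_subset_Icc_self).div (by fun_prop) fun t ht => by linarith [ht.2]

theorem hasDerivWithinAt_quantile {w : ℝ → ℝ} (hw : ContinuousOn w (Set.Icc 0 1)) (α : ℝ)
    {ξ : ℝ} (hξ : ξ ∈ Set.Ico (0 : ℝ) 1) :
    HasDerivWithinAt (quantile w α) ((1 - α / 2) * (w ξ / (1 - ξ)) + α) (Set.Ico 0 1) ξ := by
  -- As `w` is controlled only on `[0, 1]`, it is replaced by a continuous extension to the line.
  -- This gives a two-sided derivative, also at `ξ = 0`, and `φ` on `[0, 1)` is unchanged.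
  set W : ℝ → ℝ := Set.IccExtend zero_le_one (Set.domRestrict (Set.Icc (0 : ℝ) 1) w) with hW
  have hWc : Continuous W := (continuousOn_iff_continuous_domRestrict.1 hw).Icc_extend'
  have hWw : ∀ t ∈ Set.Icc (0 : ℝ) 1, W t = w t := fun t ht => Set.IccExtend_of_mem _ _ ht
  have hcong : ∀ x ∈ Set.Ico (0 : ℝ) 1, quantile w α x = quantile W α x := by
    intro x hx
    unfold quantile
    rw [intervalIntegral.integral_congr]
    intro t ht
    rw [Set.uIcc_of_le hx.1] at ht
    simp only [hWw t ⟨ht.1, ht.2.trans hx.2.le⟩]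
  have hint : IntervalIntegrable (fun t => W t / (1 - t)) volume 0 ξ := by
    refine ContinuousOn.intervalIntegrable ?_
    rw [Set.uIcc_of_le hξ.1]
    exact (continuousOn_weight_div hWc.continuousOn).mono fun t ht =>
      ⟨ht.1, ht.2.trans_lt hξ.2⟩
  have hd : HasDerivAt (fun x => ∫ t in (0 : ℝ)..x, W t / (1 - t)) (W ξ / (1 - ξ)) ξ :=
    intervalIntegral.integral_hasDerivAt_right hint
      (Measurable.stronglyMeasurable (by fun_prop)).stronglyMeasurableAtFilter
      (hWc.continuousAt.div (by fun_prop) (by linarith [hξ.2]))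
  have := (hd.const_mul (1 - α / 2)).add ((hasDerivAt_id ξ).const_mul α)
  rw [mul_one, hWw ξ ⟨hξ.1, hξ.2.le⟩] at this
  exact this.hasDerivWithinAt.congr hcong (hcong ξ hξ)

theorem quantile_deriv_pos {w : ℝ → ℝ} (hw_nonneg : ∀ t ∈ Set.Icc (0 : ℝ) 1, 0 ≤ w t) {α : ℝ}
    (hα : α ∈ Set.Ioo (0 : ℝ) 2) {ξ : ℝ} (hξ : ξ ∈ Set.Ico (0 : ℝ) 1) :
    0 < (1 - α / 2) * (w ξ / (1 - ξ)) + α :=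
  add_pos_of_nonneg_of_pos (mul_nonneg (by linarith [hα.2])
    (div_nonneg (hw_nonneg ξ ⟨hξ.1, hξ.2.le⟩) (by linarith [hξ.2]))) hα.1

theorem derivWithin_quantile {w : ℝ → ℝ} (hw : ContinuousOn w (Set.Icc 0 1)) (α : ℝ)
    {ξ : ℝ} (hξ : ξ ∈ Set.Ico (0 : ℝ) 1) :
    derivWithin (quantile w α) (Set.Ico 0 1) ξ = (1 - α / 2) * (w ξ / (1 - ξ)) + α :=
  (hasDerivWithinAt_quantile hw α hξ).derivWithin (uniqueDiffOn_Ico 0 1 ξ hξ)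

theorem continuousOn_quantile {w : ℝ → ℝ} (hw : ContinuousOn w (Set.Icc 0 1)) (α : ℝ) :
    ContinuousOn (quantile w α) (Set.Ico 0 1) := fun _ hξ =>
  (hasDerivWithinAt_quantile hw α hξ).continuousWithinAt

theorem strictMonoOn_quantile {w : ℝ → ℝ} (hw : ContinuousOn w (Set.Icc 0 1))
    (hw_nonneg : ∀ t ∈ Set.Icc (0 : ℝ) 1, 0 ≤ w t) {α : ℝ} (hα : α ∈ Set.Ioo (0 : ℝ) 2) :
    StrictMonoOn (quantile w α) (Set.Ico 0 1) := by
  refine strictMonoOn_of_hasDerivWithinAt_pos (convex_Ico 0 1) (continuousOn_quantile hw α)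
    (f' := fun ξ => (1 - α / 2) * (w ξ / (1 - ξ)) + α) (fun ξ hξ => ?_) fun ξ hξ => ?_
  · exact (hasDerivWithinAt_quantile hw α (interior_subset hξ)).mono interior_subset
  · exact quantile_deriv_pos hw_nonneg hα (interior_subset hξ)

theorem quantile_zero (w : ℝ → ℝ) (α : ℝ) : quantile w α 0 = 0 := by simp [quantile]

theorem image_quantile_subset {w : ℝ → ℝ} (hw : ContinuousOn w (Set.Icc 0 1))
    (hw_nonneg : ∀ t ∈ Set.Icc (0 : ℝ) 1, 0 ≤ w t) {α : ℝ} (hα : α ∈ Set.Ioo (0 : ℝ) 2) :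
    quantile w α '' Set.Ico 0 1 ⊆ Set.Ici 0 := by
  rintro _ ⟨ξ, hξ, rfl⟩
  rw [Set.mem_Ici, ← quantile_zero w α]
  exact (strictMonoOn_quantile hw hw_nonneg hα).monotoneOn ⟨le_rfl, one_pos⟩ hξ hξ.1

theorem limitDensity_quantile {w : ℝ → ℝ} (hw : ContinuousOn w (Set.Icc 0 1))
    (hw_nonneg : ∀ t ∈ Set.Icc (0 : ℝ) 1, 0 ≤ w t) {α : ℝ} (hα : α ∈ Set.Ioo (0 : ℝ) 2)
    {ξ : ℝ} (hξ : ξ ∈ Set.Ico (0 : ℝ) 1) :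
    limitDensity w α (quantile w α ξ) = ((1 - α / 2) * (w ξ / (1 - ξ)) + α)⁻¹ := by
  rw [limitDensity, if_pos (Set.mem_image_of_mem _ hξ),
    (strictMonoOn_quantile hw hw_nonneg hα).injOn.leftInvOn_invFunOn hξ,
    derivWithin_quantile hw α hξ, one_div]

theorem abs_deriv_smul_limitDensity {w : ℝ → ℝ} (hw : ContinuousOn w (Set.Icc 0 1))
    (hw_nonneg : ∀ t ∈ Set.Icc (0 : ℝ) 1, 0 ≤ w t) {α : ℝ} (hα : α ∈ Set.Ioo (0 : ℝ) 2)
    (χ : ℝ → ℝ) {ξ : ℝ} (hξ : ξ ∈ Set.Ico (0 : ℝ) 1) :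
    |(1 - α / 2) * (w ξ / (1 - ξ)) + α| •
      (χ (quantile w α ξ) * limitDensity w α (quantile w α ξ)) = χ (quantile w α ξ) := by
  have := quantile_deriv_pos hw_nonneg hα hξ
  rw [limitDensity_quantile hw hw_nonneg hα hξ, abs_of_pos this, smul_eq_mul, mul_left_comm,
    mul_inv_cancel₀ this.ne', mul_one]

/-- Under the limit density, `φ` is the quantile function. -/
theorem integral_mul_limitDensity {w : ℝ → ℝ} (hw : ContinuousOn w (Set.Icc 0 1))
    (hw_nonneg : ∀ t ∈ Set.Icc (0 : ℝ) 1, 0 ≤ w t) {α : ℝ} (hα : α ∈ Set.Ioo (0 : ℝ) 2)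
    (χ : ℝ → ℝ) :
    ∫ x in Set.Ici (0 : ℝ), χ x * limitDensity w α x
      = ∫ ξ in Set.Ico (0 : ℝ) 1, χ (quantile w α ξ) := by
  rw [setIntegral_eq_of_subset_of_forall_sdiff_eq_zero measurableSet_Ici
    (image_quantile_subset hw hw_nonneg hα) fun x hx => by
      rw [limitDensity, if_neg hx.2, mul_zero],
    integral_image_eq_integral_abs_deriv_smul measurableSet_Ico
      (fun ξ hξ => hasDerivWithinAt_quantile hw α hξ)
      (strictMonoOn_quantile hw hw_nonneg hα).injOn]
  exact setIntegral_congr_fun measurableSet_Ico fun ξ hξ =>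
    abs_deriv_smul_limitDensity hw hw_nonneg hα χ hξ

theorem isDensityOnHalfLine_limitDensity {w : ℝ → ℝ} (hw : ContinuousOn w (Set.Icc 0 1))
    (hw_nonneg : ∀ t ∈ Set.Icc (0 : ℝ) 1, 0 ≤ w t) {α : ℝ} (hα : α ∈ Set.Ioo (0 : ℝ) 2) :
    IsDensityOnHalfLine (limitDensity w α) := by
  refine ⟨fun x _ => ?_, ?_, ?_⟩
  · by_cases hx : x ∈ quantile w α '' Set.Ico 0 1
    · obtain ⟨ξ, hξ, rfl⟩ := hx
      rw [limitDensity_quantile hw hw_nonneg hα hξ]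
      exact inv_nonneg.2 (quantile_deriv_pos hw_nonneg hα hξ).le
    · rw [limitDensity, if_neg hx]
  -- By change of variables, integrability of `g` on the range of `φ` amounts to that of `φ' · (g ∘
  -- φ) = 1` on `[0, 1)`.
  · have h : IntegrableOn (limitDensity w α) (quantile w α '' Set.Ico 0 1) := by
      rw [integrableOn_image_iff_integrableOn_abs_deriv_smul measurableSet_Ico
        (fun ξ hξ => hasDerivWithinAt_quantile hw α hξ)
        (strictMonoOn_quantile hw hw_nonneg hα).injOn]
      refine (integrableOn_const (C := (1 : ℝ)) (by simp)).congr_fun (fun ξ hξ => ?_)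
        measurableSet_Ico
      simpa using (abs_deriv_smul_limitDensity hw hw_nonneg hα (fun _ => 1) hξ).symm
    refine h.of_forall_sdiff_eq_zero measurableSet_Ici fun x hx => ?_
    rw [limitDensity, if_neg hx.2]
  · simpa using integral_mul_limitDensity hw hw_nonneg hα fun _ => 1

/-! ### Averages as integrals of step functions, and Riemann sums -/

theorem floor_mul_lt {n : ℕ} (hn : 0 < n) {ξ : ℝ} (hξ : ξ ∈ Set.Ico (0 : ℝ) 1) :
    ⌊(n : ℝ) * ξ⌋₊ < n := by
  have hn' : (0 : ℝ) < n := by exact_mod_cast hn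
  rw [Nat.floor_lt (mul_nonneg hn'.le hξ.1)]
  nlinarith [hξ.2]

theorem integral_comp_floor_mul {n : ℕ} (hn : 0 < n) (c : ℕ → ℝ) :
    ∫ ξ in Set.Ico (0 : ℝ) 1, c ⌊(n : ℝ) * ξ⌋₊ = (n : ℝ)⁻¹ * ∑ j ∈ Finset.range n, c j := by
  have hn' : (n : ℝ) ≠ 0 := by exact_mod_cast hn.ne'
  have hj : ∀ j : ℕ, Set.EqOn (fun _ => c j) (fun x : ℝ => c ⌊x⌋₊) (Set.Ico (j : ℝ) (j + 1 : ℕ)) := by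
    intro j x hx
    have : ⌊x⌋₊ = j := by
      rw [Nat.floor_eq_iff (j.cast_nonneg.trans hx.1)]
      exact ⟨hx.1, by simpa using hx.2⟩
    simp only [this]
  have hint : ∀ j : ℕ, IntervalIntegrable (fun x : ℝ => c ⌊x⌋₊) volume j (j + 1 : ℕ) := by
    intro j
    rw [intervalIntegrable_iff_integrableOn_Ico_of_le (by exact_mod_cast j.le_succ)]
    exact (integrableOn_const (by simp)).congr_fun (hj j) measurableSet_Ico
  rw [integral_Ico_eq_integral_Ioc, ← intervalIntegral.integral_of_le zero_le_one,
    intervalIntegral.integral_comp_mul_left (fun x => c ⌊x⌋₊) hn', mul_zero, mul_one, smul_eq_mul]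
  congr 1
  have := intervalIntegral.sum_integral_adjacent_intervals (f := fun x : ℝ => c ⌊x⌋₊)
    (μ := volume) (a := fun j : ℕ => (j : ℝ)) (n := n) fun k _ => hint k
  simp only [Nat.cast_zero] at this
  rw [← this]
  refine Finset.sum_congr rfl fun j _ => ?_
  rw [intervalIntegral.integral_of_le (by exact_mod_cast j.le_succ),
    ← integral_Ico_eq_integral_Ioc, ← setIntegral_congr_fun measurableSet_Ico (hj j)]
  simp

/-- Dominated convergence for the step functions `ξ ↦ c n ⌊nξ⌋`. It serves for the Riemann sums of
the mean, for the averaged deviations and for the averages of `χ ∘ φ`. -/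
theorem tendsto_average_of_tendsto_floor {c : ℕ → ℕ → ℝ} {f : ℝ → ℝ} {C : ℝ}
    (hC : ∀ᶠ n in atTop, ∀ j < n, |c n j| ≤ C)
    (hf : ∀ᵐ ξ ∂(volume.restrict (Set.Ico (0 : ℝ) 1)),
      Tendsto (fun n : ℕ => c n ⌊(n : ℝ) * ξ⌋₊) atTop (𝓝 (f ξ))) :
    Tendsto (fun n : ℕ => (n : ℝ)⁻¹ * ∑ j ∈ Finset.range n, c n j) atTop
      (𝓝 (∫ ξ in Set.Ico (0 : ℝ) 1, f ξ)) := by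
  have h : Tendsto (fun n : ℕ => ∫ ξ in Set.Ico (0 : ℝ) 1, c n ⌊(n : ℝ) * ξ⌋₊) atTop
      (𝓝 (∫ ξ in Set.Ico (0 : ℝ) 1, f ξ)) := by
    refine tendsto_integral_filter_of_dominated_convergence (fun _ => C) ?_ ?_
      (integrable_const _) hf
    · refine Eventually.of_forall fun n => Measurable.aestronglyMeasurable ?_
      exact (measurable_from_top (f := c n)).comp (Nat.measurable_floor.comp (by fun_prop))
    · filter_upwards [hC, eventually_gt_atTop 0] with n hn hn0
      filter_upwards [ae_restrict_mem measurableSet_Ico] with ξ hξ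
      exact hn _ (floor_mul_lt hn0 hξ)
  refine h.congr' ?_
  filter_upwards [eventually_gt_atTop 0] with n hn
  exact integral_comp_floor_mul hn (c n)

theorem tendsto_floor_mul_div {ξ : ℝ} (hξ : 0 ≤ ξ) :
    Tendsto (fun n : ℕ => (⌊(n : ℝ) * ξ⌋₊ : ℝ) / n) atTop (𝓝 ξ) := by
  have := (tendsto_nat_floor_mul_div_atTop hξ).comp (tendsto_natCast_atTop_atTop (R := ℝ))
  simpa [Function.comp_def, mul_comm] using this

/-- The cell weights with a natural number index. -/
noncomputable def natCellWeight (w : ℝ → ℝ) (n k : ℕ) : ℝ :=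
  ∫ t in ((k : ℝ) / n)..(((k : ℝ) + 1) / n), w t

theorem cellWeight_eq (w : ℝ → ℝ) (n : ℕ) (j : Fin n) : cellWeight w n j = natCellWeight w n j :=
  rfl

theorem cell_subset {n k : ℕ} (hk : k < n) :
    Set.Icc ((k : ℝ) / n) (((k : ℝ) + 1) / n) ⊆ Set.Icc 0 1 := by
  have hn : (0 : ℝ) < n := by exact_mod_cast (by omega : 0 < n)
  have hk' : (k : ℝ) + 1 ≤ n := by exact_mod_cast hk
  exact Set.Icc_subset_Icc (by positivity) ((div_le_one hn).2 hk')

theorem cell_le (n k : ℕ) : (k : ℝ) / n ≤ ((k : ℝ) + 1) / n := by gcongr; linarith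

theorem intervalIntegrable_cell {w : ℝ → ℝ} (hw : ContinuousOn w (Set.Icc 0 1)) {n k : ℕ}
    (hk : k < n) : IntervalIntegrable w volume ((k : ℝ) / n) (((k : ℝ) + 1) / n) := by
  refine ContinuousOn.intervalIntegrable ?_
  rw [Set.uIcc_of_le (cell_le n k)]
  exact hw.mono (cell_subset hk)

theorem natCellWeight_nonneg {w : ℝ → ℝ} (hw_nonneg : ∀ t ∈ Set.Icc (0 : ℝ) 1, 0 ≤ w t) {n k : ℕ}
    (hk : k < n) : 0 ≤ natCellWeight w n k :=
  intervalIntegral.integral_nonneg (cell_le n k) fun t ht => hw_nonneg t (cell_subset hk ht)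

theorem sum_natCellWeight {w : ℝ → ℝ} (hw : ContinuousOn w (Set.Icc 0 1)) {n : ℕ} (hn : 0 < n) :
    ∑ k ∈ Finset.range n, natCellWeight w n k = ∫ t in (0 : ℝ)..1, w t := by
  have hn' : (n : ℝ) ≠ 0 := by exact_mod_cast hn.ne'
  have := intervalIntegral.sum_integral_adjacent_intervals (f := w)
    (μ := volume) (a := fun j : ℕ => (j : ℝ) / n) (n := n) fun k hk => by
      simpa using intervalIntegrable_cell hw hk
  simpa [natCellWeight, hn'] using this

/-- Since the cell has length `1 / n`, `n` times its weight is the mean of `w` over the cell. -/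
theorem abs_mul_natCellWeight_sub_le {w : ℝ → ℝ} (hw : ContinuousOn w (Set.Icc 0 1)) {n k : ℕ}
    (hk : k < n) {y e : ℝ}
    (h : ∀ t ∈ Set.Icc ((k : ℝ) / n) (((k : ℝ) + 1) / n), |w t - y| ≤ e) :
    |n * natCellWeight w n k - y| ≤ e := by
  have hn : (0 : ℝ) < n := by exact_mod_cast (by omega : 0 < n)
  have h1 : natCellWeight w n k - y / n = ∫ t in ((k : ℝ) / n)..(((k : ℝ) + 1) / n), (w t - y) := by
    rw [intervalIntegral.integral_sub (intervalIntegrable_cell hw hk)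
      intervalIntegrable_const, natCellWeight,
      intervalIntegral.integral_const, smul_eq_mul]
    ring
  have h2 : |natCellWeight w n k - y / n| ≤ e * (1 / n) := by
    rw [h1]
    refine (intervalIntegral.norm_integral_le_of_norm_le_const
      (f := fun t => w t - y) (C := e) fun t ht => ?_).trans ?_
    · rw [Set.uIoc_of_le (cell_le n k)] at ht
      exact h t ⟨ht.1.le, ht.2⟩
    · rw [← sub_div, add_sub_cancel_left, abs_of_pos (by positivity)]
  have h3 : n * natCellWeight w n k - y = n * (natCellWeight w n k - y / n) := by
    field_simp
  rw [h3, abs_mul, abs_of_pos hn]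
  calc n * |natCellWeight w n k - y / n| ≤ n * (e * (1 / n)) := by gcongr
    _ = e := by field_simp

theorem tendsto_mul_natCellWeight {w : ℝ → ℝ} (hw : ContinuousOn w (Set.Icc 0 1)) {t : ℝ}
    (ht : t ∈ Set.Ico (0 : ℝ) 1) :
    Tendsto (fun n : ℕ => n * natCellWeight w n ⌊(n : ℝ) * t⌋₊) atTop (𝓝 (w t)) := by
  rw [Metric.tendsto_atTop]
  intro e he
  obtain ⟨d, hd, hwd⟩ := Metric.continuousOn_iff.1 hw t ⟨ht.1, ht.2.le⟩ (e / 2) (by positivity)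
  -- For `n > 1 / d` the cells are shorter than `d`, and the cell of index `⌊nt⌋` contains `t`.
  obtain ⟨N, hN⟩ := exists_nat_gt (1 / d)
  refine ⟨max N 1, fun n hn => ?_⟩
  have hn1 : 0 < n := lt_of_lt_of_le one_pos ((le_max_right _ _).trans hn)
  have hn0 : (0 : ℝ) < n := by exact_mod_cast hn1
  have hnd : 1 / d < n := hN.trans_le (by exact_mod_cast (le_max_left _ _).trans hn)
  have hk := floor_mul_lt hn1 ht
  have hle := Nat.floor_le (mul_nonneg hn0.le ht.1)
  have hlt := Nat.lt_floor_add_one ((n : ℝ) * t)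
  rw [Real.dist_eq]
  refine lt_of_le_of_lt (abs_mul_natCellWeight_sub_le hw hk fun u hu => ?_) (half_lt_self he)
  refine (hwd u (cell_subset hk hu) ?_).le
  have h1 : 1 / (n : ℝ) < d := by rwa [one_div_lt hn0 hd]
  have h2 : (⌊(n : ℝ) * t⌋₊ : ℝ) / n ≤ t := by rw [div_le_iff₀ hn0]; linarith
  have h3 : t < ((⌊(n : ℝ) * t⌋₊ : ℝ) + 1) / n := by rw [lt_div_iff₀ hn0]; linarith
  have h4 := hu.1
  have h5 := hu.2
  rw [add_div] at h3 h5
  rw [Real.dist_eq, abs_lt]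
  constructor <;> linarith

theorem exists_bound_mul_natCellWeight {w : ℝ → ℝ} (hw : ContinuousOn w (Set.Icc 0 1)) :
    ∃ M, ∀ n k : ℕ, k < n → |n * natCellWeight w n k| ≤ M := by
  obtain ⟨M, hM⟩ := isCompact_Icc.exists_bound_of_continuousOn hw
  refine ⟨M, fun n k hk => ?_⟩
  have := abs_mul_natCellWeight_sub_le hw hk (y := 0) (e := M) fun t ht => by
    simpa using hM t (cell_subset hk ht)
  simpa using this

/-- The weighted Riemann sums converge to `∫_0^ξ w(t) / (1 - t) dt`. -/
theorem tendsto_average_weight {w : ℝ → ℝ} (hw : ContinuousOn w (Set.Icc 0 1)) {ξ : ℝ}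
    (hξ : ξ ∈ Set.Ico (0 : ℝ) 1) :
    Tendsto (fun n : ℕ => (n : ℝ)⁻¹ * ∑ k ∈ Finset.range n,
      if k ≤ ⌊(n : ℝ) * ξ⌋₊ then n * natCellWeight w n k / (1 - k / n) else 0) atTop
      (𝓝 (∫ t in (0 : ℝ)..ξ, w t / (1 - t))) := by
  obtain ⟨M, hM⟩ := exists_bound_mul_natCellWeight hw
  have hlim : ∫ t in (0 : ℝ)..ξ, w t / (1 - t)
      = ∫ t in Set.Ico (0 : ℝ) 1, (Set.Ico 0 ξ).indicator (fun t => w t / (1 - t)) t := by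
    rw [intervalIntegral.integral_of_le hξ.1, ← integral_Ico_eq_integral_Ioc,
      setIntegral_indicator measurableSet_Ico, Set.Ico_inter_Ico, max_self, min_eq_right hξ.2.le]
  rw [hlim]
  have h1ξ : 0 < 1 - ξ := by linarith [hξ.2]
  -- Only indices with `k / n ≤ ξ` contribute, so the denominators stay above `1 - ξ`.
  refine tendsto_average_of_tendsto_floor (C := M / (1 - ξ)) ?_ ?_
  · filter_upwards [eventually_gt_atTop 0] with n hn k hk
    have hn0 : (0 : ℝ) < n := by exact_mod_cast hn
    have hM0 : 0 ≤ M := (abs_nonneg _).trans (hM n k hk)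
    split_ifs with h
    · have h2 : (k : ℝ) / n ≤ ξ := by
        rw [div_le_iff₀ hn0, mul_comm]
        exact (Nat.le_floor_iff (mul_nonneg hn0.le hξ.1)).1 h
      rw [abs_div, abs_of_pos (by linarith : (0 : ℝ) < 1 - k / n)]
      have := hM n k hk
      gcongr
    · rw [abs_zero]; positivity
  -- At the cut-off `t = ξ` the terms need not tend to the indicator; this point is null.
  · have hne : ∀ᵐ t ∂(volume.restrict (Set.Ico (0 : ℝ) 1)), t ≠ ξ :=
      ae_restrict_of_ae (Measure.ae_ne volume ξ)
    filter_upwards [ae_restrict_mem measurableSet_Ico, hne] with t ht htξ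
    rcases lt_or_gt_of_ne htξ with h | h
    · rw [Set.indicator_of_mem (by exact ⟨ht.1, h⟩)]
      have := (tendsto_mul_natCellWeight hw ht).div ((tendsto_floor_mul_div ht.1).const_sub 1)
        (by linarith [ht.2])
      refine this.congr fun n => ?_
      rw [if_pos (Nat.floor_mono (by gcongr))]
      rfl
    · rw [Set.indicator_of_notMem (fun h' => h'.2.not_gt h)]
      refine tendsto_const_nhds.congr' ?_
      -- Once `n (t - ξ) > 1`, `⌊nt⌋` exceeds `⌊nξ⌋` and the term is zero.
      obtain ⟨N, hN⟩ := exists_nat_gt (1 / (t - ξ))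
      filter_upwards [eventually_ge_atTop N] with n hn
      have htξ' : 0 < t - ξ := by linarith
      have hn' : 1 / (t - ξ) < n := hN.trans_le (by exact_mod_cast hn)
      rw [div_lt_iff₀ htξ'] at hn'
      rw [if_neg]
      intro hle
      have h1 : (⌊(n : ℝ) * t⌋₊ : ℝ) ≤ ⌊(n : ℝ) * ξ⌋₊ := by exact_mod_cast hle
      have h2 := Nat.floor_le (mul_nonneg n.cast_nonneg hξ.1 : 0 ≤ (n : ℝ) * ξ)
      have h3 := Nat.lt_floor_add_one ((n : ℝ) * t)
      nlinarith

/-! ### Mean and variance of the components of `T_n` -/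

theorem sum_mul_cellWeight {w : ℝ → ℝ} (hw : ContinuousOn w (Set.Icc 0 1))
    (hw_int : ∫ t in (0 : ℝ)..1, w t = 1) {n : ℕ} (hn : 0 < n) :
    ∑ j : Fin n, n * cellWeight w n j = n := by
  simp_rw [cellWeight_eq]
  rw [← Finset.mul_sum, ← Finset.sum_range (natCellWeight w n), sum_natCellWeight hw hn, hw_int,
    mul_one]

theorem mul_cellWeight_nonneg {w : ℝ → ℝ} (hw_nonneg : ∀ t ∈ Set.Icc (0 : ℝ) 1, 0 ≤ w t) {n : ℕ}
    (j : Fin n) : 0 ≤ n * cellWeight w n j :=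
  mul_nonneg n.cast_nonneg (natCellWeight_nonneg hw_nonneg j.2)

theorem simplexParam_eq_sum (n : ℕ) (β : ℝ) (z : Fin n → ℝ) (j : Fin n) :
    simplexParam n β z j
      = ∑ k : Fin n, (if (k : ℕ) ≤ j then (1 - β / 2) * (1 / (1 - (k : ℕ) / n)) else 0) * z k
        + ((j : ℕ) : ℝ) / ((n : ℝ) - 1) * β := by
  have hn : (n : ℝ) ≠ 0 := by exact_mod_cast (Nat.zero_lt_of_lt j.2).ne'
  rw [simplexParam, Finset.mul_sum]
  congr 1
  have h : ∀ k : Fin n, (k : ℕ) ≤ j ↔ k ∈ Finset.Iic j := fun k => by rw [Finset.mem_Iic]; rfl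
  rw [← Finset.sum_subset (Finset.subset_univ (Finset.Iic j))]
  · refine Finset.sum_congr rfl fun k hk => ?_
    have hk' : (n : ℝ) - (k : ℕ) ≠ 0 := by
      have : ((k : ℕ) : ℝ) < n := by exact_mod_cast k.2
      linarith
    have : 1 - ((k : ℕ) : ℝ) / n = (n - (k : ℕ)) / n := by field_simp
    rw [if_pos ((h k).2 hk), this]
    field_simp
  · intro k _ hk
    rw [if_neg (mt (h k).1 hk), zero_mul]

/-- The expectation of component `j` of the push-forward under `T_n`. -/
noncomputable def meanParam (w : ℝ → ℝ) (n : ℕ) (β : ℝ) (j : ℕ) : ℝ :=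
  (1 - β / 2) * ((n : ℝ)⁻¹ * ∑ k ∈ Finset.range n,
      if k ≤ j then n * natCellWeight w n k / (1 - k / n) else 0)
    + (j : ℝ) / ((n : ℝ) - 1) * β

/-- The total parameter is `n` and the normalized parameters are the cell weights, which sum to one.
As `k ≤ j ≤ nξ`, all coefficients are at most `1 / (1 - ξ)`; the second term is the squared bias. -/
theorem integral_simplexParam_sub_sq_le {w : ℝ → ℝ} (hw : ContinuousOn w (Set.Icc 0 1))
    (hw_nonneg : ∀ t ∈ Set.Icc (0 : ℝ) 1, 0 ≤ w t) (hw_int : ∫ t in (0 : ℝ)..1, w t = 1) {n : ℕ}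
    {β : ℝ} (hβ : β ∈ Set.Ioo (0 : ℝ) 2) {ξ : ℝ} (hξ : ξ ∈ Set.Ico (0 : ℝ) 1) (j : Fin n)
    (hj : (j : ℝ) ≤ n * ξ) (p : ℝ) :
    ∫ z, (simplexParam n β z j - p) ^ 2 ∂(dirichletMeasure fun j : Fin n => n * cellWeight w n j)
      ≤ (1 / (1 - ξ)) ^ 2 / (n + 1) + (meanParam w n β j - p) ^ 2 := by
  have hn : 0 < n := Nat.zero_lt_of_lt j.2
  have hn0 : (0 : ℝ) < n := by exact_mod_cast hn
  have h1ξ : 0 < 1 - ξ := by linarith [hξ.2]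
  have hA := sum_mul_cellWeight hw hw_int hn
  have h := integral_affine_sq_dirichletMeasure_le
    (a := fun j : Fin n => n * cellWeight w n j) (fun j => mul_cellWeight_nonneg hw_nonneg j)
    (by rw [hA]; exact hn0)
    (fun k => if (k : ℕ) ≤ j then (1 - β / 2) * (1 / (1 - (k : ℕ) / n)) else 0)
    (((j : ℕ) : ℝ) / ((n : ℝ) - 1) * β - p)
  have hw1 : ∑ k : Fin n, cellWeight w n k = 1 := by
    rw [← Finset.mul_sum] at hA
    exact mul_left_cancel₀ hn0.ne' (by rw [hA, mul_one])
  simp only [hA, mul_div_cancel_left₀ _ hn0.ne', ← add_sub_assoc] at h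
  simp_rw [simplexParam_eq_sum]
  refine h.trans (add_le_add ?_ (le_of_eq ?_))
  · gcongr
    calc _ ≤ ∑ k : Fin n, (1 / (1 - ξ)) ^ 2 * cellWeight w n k := by
          refine Finset.sum_le_sum fun k _ => mul_le_mul_of_nonneg_right ?_
            (natCellWeight_nonneg hw_nonneg k.2)
          split_ifs with hk
          · have hk1 : ((k : ℕ) : ℝ) / n ≤ ξ := by
              rw [div_le_iff₀ hn0, mul_comm]
              exact le_trans (by exact_mod_cast hk) hj
            have hk2 : 0 < 1 - ((k : ℕ) : ℝ) / n := by linarith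
            have hβ0 : 0 ≤ 1 - β / 2 := by linarith [hβ.2]
            have hβ1 : 1 - β / 2 ≤ 1 := by linarith [hβ.1]
            refine pow_le_pow_left₀ (by positivity) ?_ 2
            calc (1 - β / 2) * (1 / (1 - (k : ℕ) / n)) ≤ 1 * (1 / (1 - ξ)) := by gcongr
              _ = _ := one_mul _
          · rw [zero_pow two_ne_zero]; positivity
      _ = (1 / (1 - ξ)) ^ 2 := by rw [← Finset.mul_sum, hw1, mul_one]
  · have e : (1 - β / 2) * ((n : ℝ)⁻¹ * ∑ k ∈ Finset.range n,
        if k ≤ (j : ℕ) then n * natCellWeight w n k / (1 - k / n) else 0)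
        = ∑ k : Fin n, (if (k : ℕ) ≤ j then (1 - β / 2) * (1 / (1 - (k : ℕ) / n)) else 0)
          * cellWeight w n k := by
      rw [Finset.sum_range, Finset.mul_sum, Finset.mul_sum]
      refine Finset.sum_congr rfl fun k _ => ?_
      rw [cellWeight_eq]
      split_ifs
      · field_simp
      · simp
    rw [meanParam, e]

theorem tendsto_meanParam {w : ℝ → ℝ} (hw : ContinuousOn w (Set.Icc 0 1)) {β : ℕ → ℝ} {α : ℝ}
    (hβ : Tendsto β atTop (𝓝 α)) {ξ : ℝ} (hξ : ξ ∈ Set.Ico (0 : ℝ) 1) :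
    Tendsto (fun n : ℕ => meanParam w n (β n) ⌊(n : ℝ) * ξ⌋₊) atTop (𝓝 (quantile w α ξ)) := by
  have h1 : Tendsto (fun n : ℕ => (⌊(n : ℝ) * ξ⌋₊ : ℝ) / ((n : ℝ) - 1)) atTop (𝓝 ξ) := by
    have h2 : Tendsto (fun n : ℕ => (1 - (n : ℝ)⁻¹)⁻¹) atTop (𝓝 1) := by
      simpa using ((tendsto_inv_atTop_nhds_zero_nat (𝕜 := ℝ)).const_sub 1).inv₀ (by simp)
    have h3 := (tendsto_floor_mul_div hξ.1).mul h2
    rw [mul_one] at h3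
    refine h3.congr' ?_
    filter_upwards [eventually_gt_atTop 1] with n hn
    have hn' : (1 : ℝ) < n := by exact_mod_cast hn
    have h4 : (n : ℝ) - 1 ≠ 0 := by linarith
    have h5 : 1 - (n : ℝ)⁻¹ = (n - 1) / n := by field_simp
    rw [h5]
    field_simp
  have := (((hβ.div_const 2).const_sub 1).mul (tendsto_average_weight hw hξ)).add (h1.mul hβ)
  rw [mul_comm ξ α] at this
  exact this

/-! ### Expected deviations of the test function -/

/-- The expected deviation of `χ(x_j)` from `χ(p)`, extended by zero to `j ≥ n`. -/
noncomputable def expectedDeviation (w : ℝ → ℝ) (n : ℕ) (β : ℝ) (χ : ℝ → ℝ) (j : ℕ) (p : ℝ) : ℝ :=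
  if hj : j < n then
    ∫ z, |χ (simplexParam n β z ⟨j, hj⟩) - χ p|
      ∂(dirichletMeasure fun j : Fin n => n * cellWeight w n j)
  else 0

/-- Continuity handles `y` near `p`; elsewhere `(y - p)² / d² ≥ 1` and the trivial bound `2‖χ‖`
suffices. With this quadratic majorant a second moment bound is enough. -/
theorem abs_sub_le_add_sq (χ : ℝ →ᵇ ℝ) {p e d : ℝ} (he : 0 < e) (hd : 0 < d)
    (h : ∀ y, |y - p| < d → |χ y - χ p| < e) (y : ℝ) :
    |χ y - χ p| ≤ e + 2 * ‖χ‖ / d ^ 2 * (y - p) ^ 2 := by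
  rcases lt_or_ge |y - p| d with hy | hy
  · have := h y hy
    have : 0 ≤ 2 * ‖χ‖ / d ^ 2 * (y - p) ^ 2 := by positivity
    linarith
  · have h1 : |χ y - χ p| ≤ 2 * ‖χ‖ := by
      have := χ.dist_le_two_norm y p
      rwa [Real.dist_eq] at this
    have h2 : d ^ 2 ≤ (y - p) ^ 2 := by
      rw [← sq_abs (y - p)]
      exact pow_le_pow_left₀ hd.le hy 2
    have h3 : 2 * ‖χ‖ ≤ 2 * ‖χ‖ / d ^ 2 * (y - p) ^ 2 := by
      rw [div_mul_eq_mul_div, le_div_iff₀ (by positivity)]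
      gcongr
    linarith

section Deviation

variable {w : ℝ → ℝ}

theorem isProbabilityMeasure_cellDirichlet (hw : ContinuousOn w (Set.Icc 0 1))
    (hw_int : ∫ t in (0 : ℝ)..1, w t = 1) {n : ℕ} (hn : 0 < n) :
    IsProbabilityMeasure (dirichletMeasure fun j : Fin n => n * cellWeight w n j) :=
  isProbabilityMeasure_dirichletMeasure
    (by rw [sum_mul_cellWeight hw hw_int hn]; exact_mod_cast hn)

theorem measurable_simplexParam_apply (n : ℕ) (β : ℝ) (j : Fin n) :
    Measurable fun z => simplexParam n β z j :=
  (measurable_pi_apply j).comp (measurable_simplexParam n β)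

theorem integrable_abs_deviation (hw : ContinuousOn w (Set.Icc 0 1))
    (hw_int : ∫ t in (0 : ℝ)..1, w t = 1) {n : ℕ} (β : ℝ) (χ : ℝ →ᵇ ℝ) (j : Fin n) (y : ℝ) :
    Integrable (fun z => |χ (simplexParam n β z j) - y|)
      (dirichletMeasure fun j : Fin n => n * cellWeight w n j) := by
  have := isProbabilityMeasure_cellDirichlet hw hw_int (Nat.zero_lt_of_lt j.2)
  have hm : Measurable fun z => |χ (simplexParam n β z j) - y| :=
    ((χ.continuous.measurable.comp (measurable_simplexParam_apply n β j)).sub_const y).abs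
  refine Integrable.of_bound hm.aestronglyMeasurable (‖χ‖ + |y|) (ae_of_all _ fun z => ?_)
  rw [Real.norm_eq_abs, abs_abs]
  exact (abs_sub _ _).trans (add_le_add_left (χ.norm_coe_le_norm _) _)

theorem integrable_simplexParam_sub_sq (hw : ContinuousOn w (Set.Icc 0 1))
    (hw_int : ∫ t in (0 : ℝ)..1, w t = 1) {n : ℕ} (hn : 2 ≤ n) {β : ℝ}
    (hβ : β ∈ Set.Ioo (0 : ℝ) 2) (j : Fin n) (p : ℝ) :
    Integrable (fun z => (simplexParam n β z j - p) ^ 2)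
      (dirichletMeasure fun j : Fin n => n * cellWeight w n j) := by
  have := isProbabilityMeasure_cellDirichlet hw hw_int (Nat.zero_lt_of_lt j.2)
  have hA : 0 < ∑ j : Fin n, n * cellWeight w n j := by
    rw [sum_mul_cellWeight hw hw_int (by omega)]
    exact_mod_cast (by omega : 0 < n)
  refine Integrable.of_bound
    (((measurable_simplexParam_apply n β j).sub_const p).pow_const 2).aestronglyMeasurable
    ((n + |p|) ^ 2) ?_
  filter_upwards [ae_mem_stdSimplex_dirichletMeasure hA] with z hz
  have h := simplexParam_mem_closedStateSpace hn hβ.1.le hβ.2.le hz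
  have h1 : |simplexParam n β z j| ≤ n := by
    rw [abs_of_nonneg (h.1 j), ← h.2.1]
    exact Finset.single_le_sum (fun i _ => h.1 i) (Finset.mem_univ j)
  rw [Real.norm_eq_abs, abs_pow]
  exact pow_le_pow_left₀ (abs_nonneg _) ((abs_sub _ _).trans (add_le_add_left h1 _)) 2

theorem expectedDeviation_le (hw : ContinuousOn w (Set.Icc 0 1))
    (hw_nonneg : ∀ t ∈ Set.Icc (0 : ℝ) 1, 0 ≤ w t) (hw_int : ∫ t in (0 : ℝ)..1, w t = 1)
    {n : ℕ} (hn : 2 ≤ n) {β : ℝ} (hβ : β ∈ Set.Ioo (0 : ℝ) 2) (χ : ℝ →ᵇ ℝ) {ξ : ℝ}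
    (hξ : ξ ∈ Set.Ico (0 : ℝ) 1) {p e d : ℝ} (he : 0 < e) (hd : 0 < d)
    (h : ∀ y, |y - p| < d → |χ y - χ p| < e) :
    expectedDeviation w n β χ ⌊(n : ℝ) * ξ⌋₊ p ≤ e + 2 * ‖χ‖ / d ^ 2 *
      ((1 / (1 - ξ)) ^ 2 / (n + 1) + (meanParam w n β ⌊(n : ℝ) * ξ⌋₊ - p) ^ 2) := by
  have := isProbabilityMeasure_cellDirichlet hw hw_int (by omega : 0 < n)
  have hj := floor_mul_lt (by omega : 0 < n) hξ
  have hi := integrable_simplexParam_sub_sq hw hw_int hn hβ ⟨_, hj⟩ p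
  rw [expectedDeviation, dif_pos hj]
  calc _ ≤ ∫ z, (e + 2 * ‖χ‖ / d ^ 2 * (simplexParam n β z ⟨_, hj⟩ - p) ^ 2)
        ∂(dirichletMeasure fun j : Fin n => n * cellWeight w n j) :=
        integral_mono (integrable_abs_deviation hw hw_int β χ ⟨_, hj⟩ _)
          ((integrable_const e).add (hi.const_mul _)) fun z => abs_sub_le_add_sq χ he hd h _
    _ = e + 2 * ‖χ‖ / d ^ 2 * ∫ z, (simplexParam n β z ⟨_, hj⟩ - p) ^ 2
        ∂(dirichletMeasure fun j : Fin n => n * cellWeight w n j) := by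
        rw [integral_add (integrable_const e) (hi.const_mul _), integral_const_mul]
        simp
    _ ≤ _ := by
        gcongr
        exact integral_simplexParam_sub_sq_le hw hw_nonneg hw_int hβ hξ ⟨_, hj⟩
          (Nat.floor_le (mul_nonneg n.cast_nonneg hξ.1)) p

theorem expectedDeviation_nonneg (n : ℕ) (β : ℝ) (χ : ℝ → ℝ) (j : ℕ) (p : ℝ) :
    0 ≤ expectedDeviation w n β χ j p := by
  unfold expectedDeviation
  split_ifs
  · exact integral_nonneg fun _ => abs_nonneg _
  · exact le_rfl

theorem expectedDeviation_le_two_norm (hw : ContinuousOn w (Set.Icc 0 1))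
    (hw_int : ∫ t in (0 : ℝ)..1, w t = 1) {n : ℕ} (β : ℝ) (χ : ℝ →ᵇ ℝ) (j : ℕ) (p : ℝ) :
    expectedDeviation w n β χ j p ≤ 2 * ‖χ‖ := by
  unfold expectedDeviation
  split_ifs with hj
  · have := isProbabilityMeasure_cellDirichlet hw hw_int (Nat.zero_lt_of_lt hj)
    refine (integral_mono (integrable_abs_deviation hw hw_int β χ ⟨_, hj⟩ _)
      (integrable_const (2 * ‖χ‖)) fun z => ?_).trans (by simp)
    exact (Real.dist_eq _ _).symm.trans_le (χ.dist_le_two_norm _ _)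
  · positivity

/-- Allows the reference point `φ(ξ)` to be replaced by `φ(⌊nξ⌋ / n)`, which depends on the index
alone. -/
theorem expectedDeviation_le_add (hw : ContinuousOn w (Set.Icc 0 1))
    (hw_int : ∫ t in (0 : ℝ)..1, w t = 1) {n : ℕ} (β : ℝ) (χ : ℝ →ᵇ ℝ) (j : ℕ) (p q : ℝ) :
    expectedDeviation w n β χ j q ≤ expectedDeviation w n β χ j p + |χ p - χ q| := by
  unfold expectedDeviation
  split_ifs with hj
  · have := isProbabilityMeasure_cellDirichlet hw hw_int (Nat.zero_lt_of_lt hj)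
    have hi := integrable_abs_deviation hw hw_int β χ ⟨_, hj⟩ (χ p)
    refine (integral_mono (integrable_abs_deviation hw hw_int β χ ⟨_, hj⟩ _)
      (hi.add (integrable_const |χ p - χ q|)) fun z => abs_sub_le _ (χ p) _).trans ?_
    simp only [Pi.add_apply]
    rw [integral_add hi (integrable_const _)]
    simp
  · positivity

end Deviation

theorem tendsto_expectedDeviation {w : ℝ → ℝ} (hw : ContinuousOn w (Set.Icc 0 1))
    (hw_nonneg : ∀ t ∈ Set.Icc (0 : ℝ) 1, 0 ≤ w t) (hw_int : ∫ t in (0 : ℝ)..1, w t = 1)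
    {β : ℕ → ℝ} (hβ : ∀ n, 2 ≤ n → β n ∈ Set.Ioo (0 : ℝ) 2) {α : ℝ}
    (hlim : Tendsto β atTop (𝓝 α)) (χ : ℝ →ᵇ ℝ) {ξ : ℝ} (hξ : ξ ∈ Set.Ico (0 : ℝ) 1) :
    Tendsto (fun n : ℕ => expectedDeviation w n (β n) χ ⌊(n : ℝ) * ξ⌋₊ (quantile w α ξ)) atTop
      (𝓝 0) := by
  rw [Metric.tendsto_atTop']
  intro e he
  obtain ⟨d, hd, h⟩ := Metric.continuousAt_iff.1 (χ.continuous.continuousAt (x := quantile w α ξ))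
    (e / 2) (by positivity)
  -- Variance bound and squared bias both vanish in the limit, leaving only the continuity error `e
  -- / 2`.
  have hsq : Tendsto (fun n : ℕ => e / 2 + 2 * ‖χ‖ / d ^ 2 * ((1 / (1 - ξ)) ^ 2 / ((n : ℝ) + 1)
      + (meanParam w n (β n) ⌊(n : ℝ) * ξ⌋₊ - quantile w α ξ) ^ 2)) atTop (𝓝 (e / 2)) := by
    have h1 : Tendsto (fun n : ℕ => (1 / (1 - ξ)) ^ 2 / ((n : ℝ) + 1)) atTop (𝓝 0) :=
      tendsto_const_nhds.div_atTop
        (tendsto_atTop_add_const_right _ 1 tendsto_natCast_atTop_atTop)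
    have h2 := ((tendsto_meanParam hw hlim hξ).sub_const (quantile w α ξ)).pow 2
    simpa using ((h1.add h2).const_mul (2 * ‖χ‖ / d ^ 2)).const_add (e / 2)
  have hev := (hsq.eventually_lt_const (half_lt_self he)).and (eventually_ge_atTop 2)
  obtain ⟨N, hN⟩ := eventually_atTop.1 hev
  refine ⟨N, fun n hn => ?_⟩
  obtain ⟨hlt, hn2⟩ := hN n hn.le
  rw [Real.dist_eq, sub_zero, abs_of_nonneg (expectedDeviation_nonneg _ _ _ _ _)]
  exact (expectedDeviation_le hw hw_nonneg hw_int hn2 (hβ n hn2) χ hξ (half_pos he) hd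
    fun y hy => h hy).trans_lt hlt

/-! ### Convergence in probability -/

theorem tendsto_quantile_floor {w : ℝ → ℝ} (hw : ContinuousOn w (Set.Icc 0 1)) (α : ℝ)
    (χ : ℝ →ᵇ ℝ) {ξ : ℝ} (hξ : ξ ∈ Set.Ico (0 : ℝ) 1) :
    Tendsto (fun n : ℕ => χ (quantile w α ((⌊(n : ℝ) * ξ⌋₊ : ℝ) / n))) atTop
      (𝓝 (χ (quantile w α ξ))) := by
  refine (χ.continuous.tendsto _).comp ((continuousOn_quantile hw α ξ hξ).tendsto.comp
    (tendsto_nhdsWithin_iff.2 ⟨tendsto_floor_mul_div hξ.1, ?_⟩))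
  filter_upwards [eventually_gt_atTop 0] with n hn
  have hn0 : (0 : ℝ) < n := by exact_mod_cast hn
  exact ⟨by positivity, (div_lt_one hn0).2 (by exact_mod_cast floor_mul_lt hn hξ)⟩

/-- Triangle inequality through the deterministic average of `χ(q_j)`: a random error, bounded
termwise, and the error of a quadrature rule. Integrability is kept for Markov's inequality. -/
theorem integral_deviation_le {w : ℝ → ℝ} (hw : ContinuousOn w (Set.Icc 0 1))
    (hw_int : ∫ t in (0 : ℝ)..1, w t = 1) {n : ℕ} (hn : 0 < n) (β : ℝ) (χ : ℝ →ᵇ ℝ) (q : ℕ → ℝ)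
    (I : ℝ) :
    Integrable (fun z => |(n : ℝ)⁻¹ * ∑ j, χ (simplexParam n β z j) - I|)
      (dirichletMeasure fun j : Fin n => n * cellWeight w n j) ∧
    ∫ z, |(n : ℝ)⁻¹ * ∑ j, χ (simplexParam n β z j) - I|
        ∂(dirichletMeasure fun j : Fin n => n * cellWeight w n j)
      ≤ (n : ℝ)⁻¹ * ∑ j ∈ Finset.range n, expectedDeviation w n β χ j (q j)
        + |(n : ℝ)⁻¹ * ∑ j ∈ Finset.range n, χ (q j) - I| := by
  have := isProbabilityMeasure_cellDirichlet hw hw_int hn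
  have hi := fun j : Fin n => integrable_abs_deviation hw hw_int β χ j (χ (q j))
  have hsum : Integrable (fun z => (n : ℝ)⁻¹ * ∑ j : Fin n, |χ (simplexParam n β z j) - χ (q j)|)
      (dirichletMeasure fun j : Fin n => n * cellWeight w n j) :=
    (integrable_finsetSum _ fun j _ => hi j).const_mul _
  have hle : ∀ z : Fin n → ℝ, |(n : ℝ)⁻¹ * ∑ j, χ (simplexParam n β z j) - I|
      ≤ (n : ℝ)⁻¹ * ∑ j : Fin n, |χ (simplexParam n β z j) - χ (q j)|
        + |(n : ℝ)⁻¹ * ∑ j ∈ Finset.range n, χ (q j) - I| := by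
    intro z
    refine (abs_sub_le _ ((n : ℝ)⁻¹ * ∑ j ∈ Finset.range n, χ (q j)) _).trans ?_
    gcongr
    rw [Finset.sum_range, ← mul_sub, ← Finset.sum_sub_distrib, abs_mul,
      abs_of_nonneg (by positivity : (0 : ℝ) ≤ (n : ℝ)⁻¹)]
    gcongr
    exact Finset.abs_sum_le_sum_abs _ _
  have hm : Measurable fun z : Fin n → ℝ => |(n : ℝ)⁻¹ * ∑ j, χ (simplexParam n β z j) - I| :=
    (((Finset.measurable_sum _ fun j _ => χ.continuous.measurable.comp
      (measurable_simplexParam_apply n β j)).const_mul _).sub_const _).abs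
  have hint : Integrable (fun z => |(n : ℝ)⁻¹ * ∑ j, χ (simplexParam n β z j) - I|)
      (dirichletMeasure fun j : Fin n => n * cellWeight w n j) :=
    (hsum.add (integrable_const _)).mono' hm.aestronglyMeasurable
      (ae_of_all _ fun z => by rw [Real.norm_eq_abs, abs_abs]; exact hle z)
  refine ⟨hint, (integral_mono hint (hsum.add (integrable_const _)) hle).trans (le_of_eq ?_)⟩
  simp only [Pi.add_apply]
  rw [integral_add hsum (integrable_const _), integral_const_mul,
    integral_finsetSum _ fun j _ => hi j,
    Finset.sum_range fun j => expectedDeviation w n β χ j (q j)]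
  simp [expectedDeviation]

theorem tendsto_dirichletState_deviation {w : ℝ → ℝ} (hw : ContinuousOn w (Set.Icc 0 1))
    (hw_nonneg : ∀ t ∈ Set.Icc (0 : ℝ) 1, 0 ≤ w t) (hw_int : ∫ t in (0 : ℝ)..1, w t = 1)
    {ε : ℝ} {E : ℕ → ℝ} (hβ : ∀ n, 2 ≤ n → exclusionRatio ε E n ∈ Set.Ioo (0 : ℝ) 2) {α : ℝ}
    (hlim : Tendsto (exclusionRatio ε E) atTop (𝓝 α)) (χ : ℝ →ᵇ ℝ) {δ : ℝ} (hδ : 0 < δ) :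
    Tendsto (fun n => dirichletState w ε E n {x | δ < |∫ y, χ y ∂(empiricalMeasure x)
      - ∫ ξ in Set.Ico (0 : ℝ) 1, χ (quantile w α ξ)|}) atTop (𝓝 0) := by
  set I := ∫ ξ in Set.Ico (0 : ℝ) 1, χ (quantile w α ξ) with hI
  -- The reference point of particle `j` is the quantile at the left end of its cell, so it stays
  -- inside `[0, 1)`, where `φ` is continuous.
  let q : ℕ → ℕ → ℝ := fun n j => quantile w α ((j : ℝ) / n)
  have hdev : Tendsto (fun n : ℕ => (n : ℝ)⁻¹ * ∑ j ∈ Finset.range n,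
      expectedDeviation w n (exclusionRatio ε E n) χ j (q n j)) atTop (𝓝 0) := by
    have := tendsto_average_of_tendsto_floor (f := fun _ => 0) (C := 2 * ‖χ‖)
      (c := fun n j => expectedDeviation w n (exclusionRatio ε E n) χ j (q n j))
      (Eventually.of_forall fun n j _ => by
        rw [abs_of_nonneg (expectedDeviation_nonneg _ _ _ _ _)]
        exact expectedDeviation_le_two_norm hw hw_int _ χ j _) ?_
    · simpa using this
    · filter_upwards [ae_restrict_mem measurableSet_Ico] with ξ hξ
      have h1 := tendsto_expectedDeviation hw hw_nonneg hw_int hβ hlim χ hξ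
      have h2 := ((tendsto_quantile_floor hw α χ hξ).const_sub (χ (quantile w α ξ))).abs
      have h3 := h1.add h2
      rw [sub_self, abs_zero, add_zero] at h3
      exact squeeze_zero (fun n => expectedDeviation_nonneg _ _ _ _ _)
        (fun n => expectedDeviation_le_add hw hw_int _ χ _ _ _) h3
  have hmean : Tendsto (fun n : ℕ => |(n : ℝ)⁻¹ * ∑ j ∈ Finset.range n, χ (q n j) - I|) atTop
      (𝓝 0) := by
    have := tendsto_average_of_tendsto_floor (f := fun ξ => χ (quantile w α ξ)) (C := ‖χ‖)
      (c := fun n j => χ (q n j))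
      (Eventually.of_forall fun n j _ => χ.norm_coe_le_norm _) (by
        filter_upwards [ae_restrict_mem measurableSet_Ico] with ξ hξ
        exact tendsto_quantile_floor hw α χ hξ)
    rw [← hI] at this
    simpa using (this.sub_const I).abs
  have hbound := ENNReal.tendsto_ofReal ((hdev.add hmean).div_const δ)
  rw [add_zero, zero_div, ENNReal.ofReal_zero] at hbound
  refine tendsto_of_tendsto_of_tendsto_of_le_of_le' tendsto_const_nhds hbound
    (Eventually.of_forall fun _ => zero_le) ?_
  filter_upwards [eventually_gt_atTop 0] with n hn
  have := isProbabilityMeasure_cellDirichlet hw hw_int hn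
  obtain ⟨hint, hle⟩ := integral_deviation_le hw hw_int hn (exclusionRatio ε E n) χ (q n) I
  rw [dirichletState_deviation, ← ENNReal.ofReal_toReal (measure_ne_top _ _)]
  refine ENNReal.ofReal_le_ofReal ?_
  rw [le_div_iff₀ hδ, mul_comm]
  -- Markov's inequality, for the larger event with `≥ δ`.
  refine le_trans ?_ ((mul_meas_ge_le_integral_of_nonneg
    (ae_of_all _ fun z => abs_nonneg _) hint δ).trans hle)
  exact mul_le_mul_of_nonneg_left (measureReal_mono (Set.ofPred_subset_ofPred.2 fun z hz => hz.le)) hδ.le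

theorem theorem3p4 (w : ℝ → ℝ) (hw_cont : ContinuousOn w (Set.Icc 0 1))
    (hw_nonneg : ∀ t ∈ Set.Icc (0 : ℝ) 1, 0 ≤ w t) (hw_int : ∫ t in (0 : ℝ)..1, w t = 1)
    (ε : ℝ) (hε : 0 < ε) (E : ℕ → ℝ) (hE : ∀ n : ℕ, 2 ≤ n → ε * n * (n - 1) / 2 < E n)
    (α : ℝ) (hα : α ∈ Set.Ioo (0 : ℝ) 2)
    (hlim : Tendsto (exclusionRatio ε E) atTop (𝓝 α)) :
    IsChaotic ε E α (limitDensity w α) (dirichletState w ε E) ∧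
      ∀ n : ℕ, 2 ≤ n → (∀ j : Fin n, 0 < cellWeight w n j) →
        ∀ᵐ x ∂(dirichletState w ε E n), x ∈ stateSpace n (rescaledSpacing ε E n) := by
  have hβ : ∀ n, 2 ≤ n → exclusionRatio ε E n ∈ Set.Ioo (0 : ℝ) 2 := fun n hn =>
    exclusionRatio_mem_Ioo hε hn (hE n hn)
  have hA : ∀ n, 2 ≤ n → 0 < ∑ j : Fin n, n * cellWeight w n j := fun n hn => by
    rw [sum_mul_cellWeight hw_cont hw_int (by omega)]
    exact_mod_cast (by omega : 0 < n)
  refine ⟨⟨hα.1, isDensityOnHalfLine_limitDensity hw_cont hw_nonneg hα, hlim,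
    fun n hn => isProbabilityMeasure_dirichletState (hA n hn),
    fun n hn => dirichletState_ae_closedStateSpace hn (hA n hn) (hβ n hn), fun χ δ hδ => ?_⟩,
    fun n hn hw => dirichletState_ae_stateSpace hn hw (hβ n hn)⟩
  rw [integral_mul_limitDensity hw_cont hw_nonneg hα χ]
  exact tendsto_dirichletState_deviation hw_cont hw_nonneg hw_int hβ hlim χ hδ
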